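/- Fix a probability space $(\Omega,\mathcal F,\mathbb P)$; sets and functions are identified when they agree almost everywhere, and $L^0$ is the ring of real random variables, with the order of a.e. dominance. Write $r<s$ if this holds a.e., and $L^0_{++}=\{r\in L^0: r>0\}$. Partitions $(A_k)$ are countable measurable partitions of $\Omega$. Let $L^0_s(\mathbb N)$ be the set of random variables with values in $\mathbb N$. An $L^0$-module $M$ is stable if for all $(x_k)\subset M$ and every partition $(A_k)$ there is a unique $x\in M$ with $1_{A_k}x=1_{A_k}x_k$ for all $k$; write $x=\sum_k1_{A_k}x_k$ (a concatenation). Concatenations in $L^0_s(\mathbb N)$ and in spaces of functions $M\to L^0$ are the obvious ones. A subset is stable if it is non-empty and closed under concatenations; a function is stable if it commutes with concatenations. A non-empty collection $\mathscr Y$ of stable sets is a stable collection if $\{\sum_k1_{A_k}y_k: y_k\in Y_k\}\in\mathscr Y$ for all $(Y_k)\subset\mathscr Y$ and all partitions $(A_k)$. A stable set is stable finite if it is the image of $\{m\in L^0_s(\mathbb N):1\le m\le n\}$ under a stable bijection, for some $n\in L^0_s(\mathbb N)$. A stable sequence is a stable function on $L^0_s(\mathbb N)$, and it converges if it does so as a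 net. A stable subsequence of $(x_n)$ is $(x_{n_k})$ for a strictly increasing stable sequence $(n_k)$ in $L^0_s(\mathbb N)$. A stable collection $\mathscr P$ of $L^0$-seminorms induces the stable topology with base the sets $\{y:\sup_{p\in\mathscr N}p(x-y)<r\}$, where $x\in M$, $r\in L^0_{++}$ and $\mathscr N\subset\mathscr P$ is stable finite. A stable set $S$ is stable compact if every filter on $S$ that has a base which is a stable collection of stable subsets of $S$ has a cluster point in $S$. It is stable sequentially compact if every stable sequence in $S$ has a stable subsequence which converges in $S$. Let $(E,\|\cdot\|)$ be a stable $L^0$-module with an $L^0$-norm, carrying the stable topology of $\{\|\cdot\|\}$. Suppose that $E$ is stable complete: every stable sequence $(x_n)$ such that for each $r\in L^0_{++}$ there is $n_0$ with $\|x_n-x_m\|\le r$ for all $n,m\ge n_0$ converges. Let $E^*$ be the set of continuous $L^0$-linear functions $f\colon E\to L^0$ ($L^0$ with the stable topology of $|\cdot|$), and let $\|f\|=\sup\{|f(x)|:\|x\|\le1\}$. Let $\sigma_s(E,E^*)$ be the stable topology on $E$ induced by the seminorms $|f(\cdot)|$, $f\in E^*$, and $\sigma_s(E^*,E)$ the one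 on $E^*$ induced by the seminorms $f\mapsto|f(x)|$, $x\in E$. **Theorem.** Assume that $\{f\in E^*:\|f\|\le1\}$ is stable sequentially compact with respect to $\sigma_s(E^*,E)$. Let $S\subset E$ be stable and $\sigma_s(E,E^*)$-closed. Then $S$ is stable $\sigma_s(E,E^*)$-compact if and only if for each $f\in E^*$ there exists $y\in S$ such that $f(y)=\sup_{x\in S}f(x)$. -/

import Mathlib

open MeasureTheory

noncomputable section

namespace StableModule

variable {Ω : Type*} [MeasurableSpace Ω]

/-- The ring `L⁰` of real-valued measurable functions modulo a.e. equality, with the order of a.e.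
dominance. -/
abbrev L0 (P : Measure Ω) := Ω →ₘ[P] ℝ

instance instCommRingL0 (P : Measure Ω) : CommRing (L0 P) :=
  { AEEqFun.instAddCommGroup, AEEqFun.instCommMonoid with
    left_distrib := fun a b c => by
      induction a using AEEqFun.induction_on
      induction b using AEEqFun.induction_on
      induction c using AEEqFun.induction_on
      simp only [AEEqFun.mk_add_mk, AEEqFun.mk_mul_mk, mul_add]
    right_distrib := fun a b c => by
      induction a using AEEqFun.induction_on
      induction b using AEEqFun.induction_on
      induction c using AEEqFun.induction_on
      simp only [AEEqFun.mk_add_mk, AEEqFun.mk_mul_mk, add_mul]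
    zero_mul := fun a => by
      induction a using AEEqFun.induction_on
      simp only [AEEqFun.zero_def, AEEqFun.mk_mul_mk, Pi.mul_def, zero_mul]
    mul_zero := fun a => by
      induction a using AEEqFun.induction_on
      simp only [AEEqFun.zero_def, AEEqFun.mk_mul_mk, Pi.mul_def, mul_zero] }

/-- `L⁰_s(ℕ)`: since `ℕ` is countable and discrete, the step functions with values in `ℕ` are
exactly the measurable ones. -/
abbrev L0N (P : Measure Ω) := Ω →ₘ[P] ℕ

/-- Strict a.e. inequality `r < s` in `L⁰`; in particular `L⁰₊₊ = {r | SLT P 0 r}`. -/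
def SLT (P : Measure Ω) (r s : L0 P) : Prop := ∀ᵐ ω ∂P, r ω < s ω

/-- The class in `L⁰` of the indicator function of a measurable set. -/
def ind (P : Measure Ω) {A : Set Ω} (hA : MeasurableSet A) : L0 P :=
  AEEqFun.mk (A.indicator fun _ => (1 : ℝ))
    (stronglyMeasurable_const.indicator hA).aestronglyMeasurable

/-- Countable measurable partitions of `Ω` (parts may be empty, so finite partitions are included).
They represent all partitions of the unit of the measure algebra. -/
structure Partition (Ω : Type*) [MeasurableSpace Ω] where
  part : ℕ → Set Ω
  measurableSet : ∀ k, MeasurableSet (part k)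
  disjoint : Pairwise fun i j => Disjoint (part i) (part j)
  iUnion_eq : ⋃ k, part k = Set.univ

section Modules

variable (P : Measure Ω) {M : Type*} [AddCommGroup M] [Module (L0 P) M]

/-- `y` is a concatenation of `(x_k)` along the partition `(A_k)`: `1_{A_k} y = 1_{A_k} x_k`. -/
def IsConcat (a : Partition Ω) (x : ℕ → M) (y : M) : Prop :=
  ∀ k, ind P (a.measurableSet k) • y = ind P (a.measurableSet k) • x k

/-- Stable `L⁰`-modules: concatenations exist and are unique. -/
def IsStableModule (M : Type*) [AddCommGroup M] [Module (L0 P) M] : Prop :=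
  ∀ (a : Partition Ω) (x : ℕ → M), ∃! y, IsConcat P a x y

/-- Stable subsets: non-empty and closed under concatenations. -/
def IsStableSet (S : Set M) : Prop :=
  S.Nonempty ∧ ∀ (a : Partition Ω) (x : ℕ → M) (y : M),
    (∀ k, x k ∈ S) → IsConcat P a x y → y ∈ S

/-- The set `∑ Y_k | a_k` of all concatenations of elements `y_k ∈ Y_k`. -/
def concatSet (a : Partition Ω) (Y : ℕ → Set M) : Set M :=
  {y | ∃ x : ℕ → M, (∀ k, x k ∈ Y k) ∧ IsConcat P a x y}

/-- Stable collections of stable subsets. -/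
def IsStableCollection (B : Set (Set M)) : Prop :=
  B.Nonempty ∧ (∀ Y ∈ B, IsStableSet P Y) ∧
    ∀ (a : Partition Ω) (Y : ℕ → Set M), (∀ k, Y k ∈ B) → concatSet P a Y ∈ B

variable {P} in
/-- `m` is the concatenation of `(n_k)` along the partition `(A_k)` in `L⁰_s(ℕ)`. -/
def IsConcatNat (a : Partition Ω) (n : ℕ → L0N P) (m : L0N P) : Prop :=
  ∀ k, ∀ᵐ ω ∂P, ω ∈ a.part k → m ω = n k ω

/-- `g`, defined on a set `D` of conditional natural numbers, is a stable function into `M`. -/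
def IsStableFunOn (D : Set (L0N P)) (g : L0N P → M) : Prop :=
  ∀ (a : Partition Ω) (n : ℕ → L0N P) (m : L0N P), (∀ k, n k ∈ D) → m ∈ D →
    IsConcatNat a n m → IsConcat P a (fun k => g (n k)) (g m)

/-- Stable sequences in `M`. -/
def IsStableSeq (x : L0N P → M) : Prop := IsStableFunOn P Set.univ x

/-- Strictly increasing stable sequences of conditional natural numbers; they index stable
subsequences. -/
def IsStableIndexSeq (n : L0N P → L0N P) : Prop :=
  (∀ (a : Partition Ω) (k : ℕ → L0N P) (m : L0N P),
    IsConcatNat a k m → IsConcatNat a (fun j => n (k j)) (n m)) ∧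
  ∀ k l : L0N P, (∀ᵐ ω ∂P, k ω < l ω) → ∀ᵐ ω ∂P, n k ω < n l ω

/-- Stable finite sets: stable sets in stable bijection with some `{1 ≤ m ≤ n}`. -/
def IsStableFinite (X : Set M) : Prop :=
  IsStableSet P X ∧ ∃ (n : L0N P) (g : L0N P → M),
    IsStableFunOn P (Set.Icc 1 n) g ∧ Set.BijOn g (Set.Icc 1 n) X

/-- The set `{y | sup_{p ∈ N} p (x - y) < r}`. -/
def basicNhd (N : Set (M → L0 P)) (x : M) (r : L0 P) : Set M :=
  {y | ∃ s : L0 P, IsLUB ((fun p : M → L0 P => p (x - y)) '' N) s ∧ SLT P s r}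

/-- The stable topology `𝒯_s(Q)` of a collection `Q` of `L⁰`-seminorms. The functions `M → L⁰` form
an `L⁰`-module under pointwise operations, which gives the concatenations `∑ 1_{A_k} p_k` used in
the notion of a stable finite subset of `Q`. -/
abbrev stableTopology (Q : Set (M → L0 P)) : TopologicalSpace M :=
  TopologicalSpace.generateFrom
    {U | ∃ (N : Set (M → L0 P)) (x : M) (r : L0 P),
      N ⊆ Q ∧ IsStableFinite P N ∧ SLT P 0 r ∧ U = basicNhd P N x r}

/-- `F` is (the image in `M` of) a stable filter on `S`: it has a filter base which is a stable
collection of stable subsets of `S`. -/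
def IsStableFilterOn (S : Set M) (F : Filter M) : Prop :=
  ∃ B : Set (Set M), IsStableCollection P B ∧ (∀ U ∈ B, U ⊆ S) ∧
    ∀ V, V ∈ F ↔ ∃ U ∈ B, U ⊆ V

/-- `S` is stable compact for (the trace on `S` of) the topology `t`: every stable filter on `S` has
a cluster point in `S`. -/
def IsStableCompact (t : TopologicalSpace M) (S : Set M) : Prop :=
  ∀ F : Filter M, IsStableFilterOn P S F → ∃ x ∈ S, @ClusterPt M t x F

/-- `S` is stable sequentially compact for `t`: every stable sequence in `S` has a stable
subsequence which converges, as a net, to an element of `S`. -/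
def IsStableSeqCompact (t : TopologicalSpace M) (S : Set M) : Prop :=
  ∀ x : L0N P → M, IsStableSeq P x → (∀ n, x n ∈ S) →
    ∃ n : L0N P → L0N P, IsStableIndexSeq P n ∧
      ∃ y ∈ S, Filter.Tendsto (fun k => x (n k)) Filter.atTop (@nhds M t y)

end Modules

/-- `L⁰`-norms on an `L⁰`-module. -/
structure L0Norm (P : Measure Ω) (E : Type*) [AddCommGroup E] [Module (L0 P) E] where
  toFun : E → L0 P
  nonneg : ∀ x, 0 ≤ toFun x
  map_smul : ∀ (r : L0 P) (x : E), toFun (r • x) = |r| * toFun x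
  add_le : ∀ x y, toFun (x + y) ≤ toFun x + toFun y
  eq_zero : ∀ x, toFun x = 0 → x = 0

namespace L0Norm

variable {P : Measure Ω} {E : Type*} [AddCommGroup E] [Module (L0 P) E] (N : L0Norm P E)

/-- The topology on `E` induced by the `L⁰`-norm. -/
abbrev topology : TopologicalSpace E := stableTopology P {N.toFun}

/-- The space is stable complete: every Cauchy stable sequence converges as a net. -/
def IsStableComplete : Prop :=
  ∀ x : L0N P → E, IsStableSeq P x →
    (∀ r : L0 P, SLT P 0 r → ∃ n₀ : L0N P, ∀ n m : L0N P, n₀ ≤ n → n₀ ≤ m →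
      N.toFun (x n - x m) ≤ r) →
    ∃ y : E, Filter.Tendsto x Filter.atTop (@nhds E N.topology y)

/-- The dual `E*`: the `L⁰`-linear functions `E → L⁰` that are continuous, where `L⁰` carries the
topology induced by the absolute value. -/
def dual : Set (E →ₗ[L0 P] L0 P) :=
  {f | @Continuous E (L0 P) N.topology (stableTopology P {fun r : L0 P => |r|}) f}

/-- The dual unit ball `{f ∈ E* | ‖f‖ ≤ 1}`, where `‖f‖ = sup {|f x| : ‖x‖ ≤ 1}`. -/
def dualBall : Set (E →ₗ[L0 P] L0 P) :=
  {f | f ∈ N.dual ∧ ∃ s : L0 P, IsLUB {r | ∃ x : E, N.toFun x ≤ 1 ∧ r = |f x|} s ∧ s ≤ 1}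

/-- The weak stable topology `σ_s(E, E*)`. -/
abbrev weakTopology : TopologicalSpace E :=
  stableTopology P {p | ∃ f ∈ N.dual, p = fun x => |f x|}

end L0Norm

/-- The topology of the seminorms `f ↦ |f x|`, `x ∈ E`, on all `L⁰`-linear functions `E → L⁰`; its
trace on `E*` is the weak-* stable topology `σ_s(E*, E)`. -/
abbrev weakStarTopology (P : Measure Ω) (E : Type*) [AddCommGroup E] [Module (L0 P) E] :
    TopologicalSpace (E →ₗ[L0 P] L0 P) :=
  stableTopology P {p | ∃ x : E, p = fun f => |f x|}

end StableModule

end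

/-! If `S` is stable compact, a cluster point of the superlevel sets of `f` in `S` maximises `f`.
The converse is James' theorem carried out over `L⁰`: each choice is made by gluing countably many
candidates along a partition. This works because infima in `L⁰` are pointwise infima of sequences
(`exists_isGLB_L0`), so local functions bounded below on sets closed under gluing have almost
minimisers (`exists_almost_min`).

Attainment bounds each `f ∈ E*` on `S`, and uniform boundedness then makes `S` norm bounded. A
stable filter on `S` is refined to a maximal stable base, along which each `f` converges to some `z
f`. Thus `z` is a weak-* limit of `S` in the bidual. If `z` is evaluation at some `x ∈ E`, the base
converges weakly to `x`; closedness gives `x ∈ S`, and `x` is the cluster point sought.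

To represent `z`, let `d` be its `L⁰`-valued distance from `E`. Helly's theorem gives functionals in
the dual ball that almost reach `d` at `z` and are small at given points. Alternating with
approximations of `z` by points of `S` produces `f j` and `x k` with `f j (x i)` close to `0` for `i
< j`, and `f i (x k)` at least about `d - ε` for `i ≤ k`. Sequential compactness of the dual ball
extracts `h j → g` pointwise with `g (x k) = 0`. The differences `h j - g` tend to `0` at every
point, although each has lower limit at least `d - ε` along `x k`. Simons' inequality excludes this
unless `d ≤ 2ε`: it yields convex series `w n` of the differences with index at least `n`, and a
maximiser `b` of `w 0` on `S`, with `w n b ≥ w 0 b - ε ≥ d - 2ε`, while `w n b` is eventually below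
any positive number. Hence `d = 0`, and completeness yields `x`. -/

noncomputable section

namespace StableModule

variable {Ω : Type*} [MeasurableSpace Ω]

/-! ### Pointwise calculus in `L⁰`, partitions and gluing. -/

section L0Basics

variable {P : Measure Ω}

theorem ae_add (r s : L0 P) : ∀ᵐ ω ∂P, (r + s) ω = r ω + s ω := AEEqFun.coeFn_add r s

theorem ae_sub (r s : L0 P) : ∀ᵐ ω ∂P, (r - s) ω = r ω - s ω := AEEqFun.coeFn_sub r s

theorem ae_neg (r : L0 P) : ∀ᵐ ω ∂P, (-r) ω = -r ω := AEEqFun.coeFn_neg r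

theorem ae_mul (r s : L0 P) : ∀ᵐ ω ∂P, (r * s) ω = r ω * s ω := AEEqFun.coeFn_mul r s

theorem ae_smul (r s : L0 P) : ∀ᵐ ω ∂P, (r • s) ω = r ω * s ω := AEEqFun.coeFn_mul r s

theorem ae_abs (r : L0 P) : ∀ᵐ ω ∂P, |r| ω = |r ω| := AEEqFun.coeFn_abs r

theorem ae_zero : ∀ᵐ ω ∂P, (0 : L0 P) ω = 0 := AEEqFun.coeFn_zero

theorem ae_one : ∀ᵐ ω ∂P, (1 : L0 P) ω = 1 := AEEqFun.coeFn_one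

theorem ae_ind {A : Set Ω} (hA : MeasurableSet A) :
    ∀ᵐ ω ∂P, ind P hA ω = A.indicator (fun _ => (1 : ℝ)) ω := AEEqFun.coeFn_mk _ _

theorem L0.le_iff {r s : L0 P} : r ≤ s ↔ ∀ᵐ ω ∂P, r ω ≤ s ω := AEEqFun.coeFn_le.symm

theorem L0.nonneg_iff {r : L0 P} : 0 ≤ r ↔ ∀ᵐ ω ∂P, 0 ≤ r ω := by
  rw [L0.le_iff]
  exact ⟨fun h => by filter_upwards [h, ae_zero (P := P)] with ω h1 h2; rwa [h2] at h1,
    fun h => by filter_upwards [h, ae_zero (P := P)] with ω h1 h2; rwa [h2]⟩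

theorem L0.abs_le_iff {r s : L0 P} : |r| ≤ s ↔ ∀ᵐ ω ∂P, |r ω| ≤ s ω := by
  rw [L0.le_iff]
  exact ⟨fun h => by filter_upwards [h, ae_abs r] with ω h1 h2; rwa [h2] at h1,
    fun h => by filter_upwards [h, ae_abs r] with ω h1 h2; rwa [h2]⟩

theorem L0.eq_iff {r s : L0 P} : r = s ↔ ∀ᵐ ω ∂P, r ω = s ω := AEEqFun.ext_iff

instance instIsOrderedAddMonoidL0 : IsOrderedAddMonoid (L0 P) where
  add_le_add_left a b h c := by
    rw [L0.le_iff] at *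
    filter_upwards [h, ae_add a c, ae_add b c] with ω h1 h2 h3
    rw [h2, h3]
    linarith

theorem SLT_zero_iff {r : L0 P} : SLT P 0 r ↔ ∀ᵐ ω ∂P, 0 < r ω := by
  unfold SLT
  exact ⟨fun h => by filter_upwards [h, ae_zero (P := P)] with ω h1 h2; rwa [h2] at h1,
    fun h => by filter_upwards [h, ae_zero (P := P)] with ω h1 h2; rwa [h2]⟩

theorem L0.measurable (r : L0 P) : Measurable r := AEEqFun.measurable r

/-- The class in `L⁰` of a measurable function. -/
theorem exists_L0 {φ : Ω → ℝ} (hφ : Measurable φ) : ∃ r : L0 P, ∀ᵐ ω ∂P, r ω = φ ω :=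
  ⟨AEEqFun.mk φ hφ.aestronglyMeasurable, AEEqFun.coeFn_mk _ _⟩

theorem exists_L0N {φ : Ω → ℕ} (hφ : Measurable φ) : ∃ r : L0N P, ∀ᵐ ω ∂P, r ω = φ ω :=
  ⟨AEEqFun.mk φ hφ.aestronglyMeasurable, AEEqFun.coeFn_mk _ _⟩

theorem exists_const (P : Measure Ω) (c : ℝ) : ∃ r : L0 P, ∀ᵐ ω ∂P, r ω = c :=
  exists_L0 measurable_const

theorem exists_pos_const (P : Measure Ω) {c : ℝ} (hc : 0 < c) :
    ∃ r : L0 P, SLT P 0 r ∧ ∀ᵐ ω ∂P, r ω = c := by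
  obtain ⟨r, hr⟩ := exists_const P c
  exact ⟨r, SLT_zero_iff.2 (by filter_upwards [hr] with ω h; rwa [h]), hr⟩

theorem measurableSet_le_L0 (r s : L0 P) : MeasurableSet {ω | r ω ≤ s ω} :=
  measurableSet_le r.measurable s.measurable

/-- A sequence of measurable sets that covers `Ω` up to a null set contains a partition. -/
theorem exists_partition {G : ℕ → Set Ω} (hG : ∀ n, MeasurableSet (G n))
    (hcover : ∀ᵐ ω ∂P, ∃ n, ω ∈ G n) :
    ∃ a : Partition Ω, ∀ k, ∀ᵐ ω ∂P, ω ∈ a.part k → ω ∈ G k := by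
  -- A `Partition` covers every point, so the null set missed by all `G k` is added to the first
  -- set.
  let G' : ℕ → Set Ω := fun n => if n = 0 then G 0 ∪ (⋃ k, G k)ᶜ else G n
  have hG' : ∀ n, MeasurableSet (G' n) := by
    intro n
    by_cases h : n = 0
    · simpa [G', h] using (hG 0).union (MeasurableSet.iUnion hG).compl
    · simpa [G', h] using hG n
  refine ⟨⟨disjointed G', fun k => MeasurableSet.disjointed hG' k, disjoint_disjointed G', ?_⟩, ?_⟩
  · rw [iUnion_disjointed]
    ext ω
    simp only [Set.mem_iUnion, Set.mem_univ, iff_true]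
    by_cases h : ∃ k, ω ∈ G k
    · obtain ⟨k, hk⟩ := h
      refine ⟨k, ?_⟩
      by_cases h0 : k = 0
      · subst h0; simp [G', hk]
      · simp [G', h0, hk]
    · exact ⟨0, by simp only [G', if_true]; right; simpa using h⟩
  · intro k
    filter_upwards [hcover] with ω hω hk
    have hk' : ω ∈ G' k := disjointed_subset G' k hk
    by_cases h0 : k = 0
    · subst h0
      simp only [G', if_true, Set.mem_union, Set.mem_compl_iff, Set.mem_iUnion] at hk'
      rcases hk' with h | h
      · exact h
      · exact absurd hω h
    · simpa [G', h0] using hk'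

theorem Partition.exists_mem (a : Partition Ω) (ω : Ω) : ∃ k, ω ∈ a.part k := by
  have : ω ∈ ⋃ k, a.part k := by rw [a.iUnion_eq]; trivial
  simpa using this

/-- A property that holds a.e. on each part holds a.e. -/
theorem Partition.ae_of_forall (a : Partition Ω) {p : Ω → Prop}
    (h : ∀ k, ∀ᵐ ω ∂P, ω ∈ a.part k → p ω) : ∀ᵐ ω ∂P, p ω := by
  filter_upwards [ae_all_iff.2 h] with ω hω
  obtain ⟨k, hk⟩ := a.exists_mem ω
  exact hω k hk

/-- The partition of `Ω` into the level sets of a conditional natural number. -/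
def levels (n : L0N P) : Partition Ω where
  part k := {ω | n ω = k}
  measurableSet k := n.measurable (measurableSet_singleton k)
  disjoint i j hij := Set.disjoint_left.2 fun ω (h1 : n ω = i) (h2 : n ω = j) =>
    hij (h1.symm.trans h2)
  iUnion_eq := by ext ω; simp

/-- Real random variables can be glued along partitions. -/
theorem exists_glue_L0 (a : Partition Ω) (r : ℕ → L0 P) :
    ∃ s : L0 P, ∀ k, ∀ᵐ ω ∂P, ω ∈ a.part k → s ω = r k ω := by
  classical
  choose κ hκ using a.exists_mem
  have huniq : ∀ {k ω}, ω ∈ a.part k → κ ω = k := by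
    intro k ω hk
    by_contra hne
    exact Set.disjoint_left.1 (a.disjoint hne) (hκ ω) hk
  have hκm : Measurable κ := by
    refine measurable_to_countable' fun k => ?_
    have : κ ⁻¹' {k} = a.part k := by
      ext ω
      exact ⟨fun h => by have := hκ ω; rwa [show κ ω = k from h] at this, fun h => huniq h⟩
    rw [this]; exact a.measurableSet k
  have hm : Measurable fun ω => r (κ ω) ω := by
    have h1 : Measurable (Function.uncurry fun (k : ℕ) (ω : Ω) => r k ω) :=
      measurable_from_prod_countable_right fun k => (r k).measurable
    exact h1.comp (hκm.prodMk measurable_id)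
  obtain ⟨s, hs⟩ := exists_L0 (P := P) hm
  refine ⟨s, fun k => ?_⟩
  filter_upwards [hs] with ω h hk
  rw [h, huniq hk]

end L0Basics

/-! ### Order completeness of `L⁰`. -/

section OrderComplete

variable {P : Measure Ω} [IsProbabilityMeasure P]

theorem integrable_arctan {φ : Ω → ℝ} (hφ : Measurable φ) :
    Integrable (fun ω => Real.arctan (φ ω)) P := by
  refine Integrable.of_bound (C := 2) (Real.measurable_arctan.comp hφ).aestronglyMeasurable
    (Filter.Eventually.of_forall fun ω => ?_)
  have h1 := Real.neg_pi_div_two_lt_arctan (φ ω)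
  have h2 := Real.arctan_lt_pi_div_two (φ ω)
  have h3 := Real.pi_lt_four
  rw [Real.norm_eq_abs, abs_le]
  constructor <;> linarith

/-- `L⁰` is conditionally complete, and infima are pointwise infima of sequences. -/
theorem exists_isGLB_L0 {T : Set (L0 P)} (hT : T.Nonempty) {b : L0 P} (hb : ∀ t ∈ T, b ≤ t) :
    ∃ g : L0 P, IsGLB T g ∧ ∃ t : ℕ → L0 P, (∀ n, t n ∈ T) ∧
      ∀ᵐ ω ∂P, ∀ ε : ℝ, 0 < ε → ∃ n, t n ω < g ω + ε := by
  let G : (ℕ → T) → Ω → ℝ := fun t ω => ⨅ n, (t n : L0 P) ω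
  have hGm : ∀ t, Measurable (G t) := fun t => Measurable.iInf fun n => (t n : L0 P).measurable
  -- Exhaustion: minimise this integral over countable subfamilies. The arctangent makes everything
  -- integrable, and its strict monotonicity turns equal integrals of comparable functions into a.e.
  -- equality.
  let I : (ℕ → T) → ℝ := fun t => ∫ ω, Real.arctan (G t ω) ∂P
  have hbdd : ∀ t : ℕ → T, ∀ᵐ ω ∂P, BddBelow (Set.range fun n => (t n : L0 P) ω) := by
    intro t
    filter_upwards [ae_all_iff.2 fun n => L0.le_iff.1 (hb (t n) (t n).2)] with ω hω
    exact ⟨b ω, by rintro _ ⟨n, rfl⟩; exact hω n⟩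
  obtain ⟨t₀, ht₀⟩ := hT
  have hmono : ∀ t t' : ℕ → T, (∀ n, ∃ m, t' m = t n) → ∀ᵐ ω ∂P, G t' ω ≤ G t ω := by
    intro t t' h
    filter_upwards [hbdd t'] with ω hω
    refine le_ciInf fun n => ?_
    obtain ⟨m, hm⟩ := h n
    rw [← hm]
    exact ciInf_le hω m
  have hImono : ∀ t t' : ℕ → T, (∀ n, ∃ m, t' m = t n) → I t' ≤ I t := by
    intro t t' h
    refine integral_mono_ae (integrable_arctan (hGm t')) (integrable_arctan (hGm t)) ?_
    filter_upwards [hmono t t' h] with ω hω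
    exact Real.arctan_strictMono.monotone hω
  have hIb : BddBelow (Set.range I) := by
    refine ⟨∫ ω, (-2 : ℝ) ∂P, ?_⟩
    rintro _ ⟨t, rfl⟩
    refine integral_mono (integrable_const _) (integrable_arctan (hGm t)) fun ω => ?_
    have h1 := Real.neg_pi_div_two_lt_arctan (G t ω)
    have h3 := Real.pi_lt_four
    change -2 ≤ Real.arctan (G t ω)
    linarith
  have : Nonempty (ℕ → T) := ⟨fun _ => ⟨t₀, ht₀⟩⟩
  have hex : ∀ k : ℕ, ∃ t : ℕ → T, I t < (⨅ t, I t) + 1 / ((k : ℝ) + 1) := fun k =>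
    exists_lt_of_ciInf_lt (lt_add_of_pos_right _ (by positivity))
  choose τ hτ using hex
  -- All the families of a minimising sequence are merged into one, which therefore attains the
  -- minimum.
  let t : ℕ → T := fun m => τ m.unpair.1 m.unpair.2
  have hIt : I t ≤ ⨅ t, I t := by
    refine le_of_forall_pos_lt_add fun ε hε => ?_
    obtain ⟨k, hk⟩ := exists_nat_one_div_lt hε
    have h1 : I t ≤ I (τ k) := hImono _ _ fun n => ⟨Nat.pair k n, by simp [t]⟩
    linarith [hτ k]
  obtain ⟨g, hg⟩ := exists_L0 (P := P) (hGm t)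
  refine ⟨g, ⟨fun s hs => ?_, fun c hc => ?_⟩, fun n => t n, fun n => (t n).2, ?_⟩
  -- Adding `s` to an optimal family cannot lower the integral, so it leaves the infimum unchanged
  -- a.e.
  · let t' : ℕ → T := fun n => Nat.casesOn n ⟨s, hs⟩ t
    have h1 := hmono t t' fun n => ⟨n + 1, rfl⟩
    have h2 : I t ≤ I t' := hIt.trans (ciInf_le hIb t')
    have h3 : (fun ω => Real.arctan (G t' ω)) =ᵐ[P] fun ω => Real.arctan (G t ω) := by
      refine (integral_eq_iff_of_ae_le (integrable_arctan (hGm t')) (integrable_arctan (hGm t)) ?_).1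
        (le_antisymm (hImono t t' fun n => ⟨n + 1, rfl⟩) h2)
      filter_upwards [h1] with ω hω
      exact Real.arctan_strictMono.monotone hω
    rw [L0.le_iff]
    filter_upwards [h3, hg, hbdd t'] with ω h4 h5 h6
    rw [h5, ← Real.arctan_strictMono.injective h4]
    exact ciInf_le h6 0
  · rw [L0.le_iff]
    filter_upwards [hg, ae_all_iff.2 fun n => L0.le_iff.1 (hc (t n).2)] with ω h5 h6
    rw [h5]
    exact le_ciInf h6
  · filter_upwards [hg] with ω h5 ε hε
    rw [h5]
    exact exists_lt_of_ciInf_lt (lt_add_of_pos_right _ hε)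

theorem exists_isLUB_L0 {T : Set (L0 P)} (hT : T.Nonempty) {b : L0 P} (hb : ∀ t ∈ T, t ≤ b) :
    ∃ g : L0 P, IsLUB T g := by
  obtain ⟨g, hg, -⟩ := exists_isGLB_L0 (T := upperBounds T) ⟨b, fun t ht => hb t ht⟩
    (b := hT.some) (fun t ht => ht hT.some_mem)
  exact ⟨g, isGLB_upperBounds.1 hg⟩

end OrderComplete

/-! ### Agreement on measurable sets, concatenations and almost minimisers. -/

section Agree

variable {P : Measure Ω} {M : Type*} [AddCommGroup M] [Module (L0 P) M]
  {M' : Type*} [AddCommGroup M'] [Module (L0 P) M']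

/-- `x` and `y` agree on `A`. -/
def AgreeOn {A : Set Ω} (hA : MeasurableSet A) (x y : M) : Prop := ind P hA • x = ind P hA • y

theorem AgreeOn.symm {A : Set Ω} {hA : MeasurableSet A} {x y : M} (h : AgreeOn (P := P) hA x y) :
    AgreeOn (P := P) hA y x := Eq.symm h

theorem AgreeOn.refl {A : Set Ω} (hA : MeasurableSet A) (x : M) : AgreeOn (P := P) hA x x := rfl

theorem AgreeOn.trans {A : Set Ω} {hA : MeasurableSet A} {x y z : M}
    (h : AgreeOn (P := P) hA x y) (h' : AgreeOn (P := P) hA y z) : AgreeOn (P := P) hA x z :=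
  Eq.trans h h'

theorem AgreeOn.map {A : Set Ω} {hA : MeasurableSet A} {x y : M} (h : AgreeOn (P := P) hA x y)
    (f : M →ₗ[L0 P] M') : AgreeOn (P := P) hA (f x) (f y) := by
  have := congrArg f (show ind P hA • x = ind P hA • y from h)
  simpa [AgreeOn] using this

theorem AgreeOn.add {A : Set Ω} {hA : MeasurableSet A} {x y x' y' : M}
    (h : AgreeOn (P := P) hA x y) (h' : AgreeOn (P := P) hA x' y') :
    AgreeOn (P := P) hA (x + x') (y + y') := by
  unfold AgreeOn at *
  rw [smul_add, smul_add, h, h']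

theorem agreeOn_L0 {A : Set Ω} {hA : MeasurableSet A} {r s : L0 P} :
    AgreeOn (P := P) hA r s ↔ ∀ᵐ ω ∂P, ω ∈ A → r ω = s ω := by
  unfold AgreeOn
  rw [L0.eq_iff]
  constructor
  · intro h
    filter_upwards [h, ae_smul (ind P hA) r, ae_smul (ind P hA) s, ae_ind hA] with ω h1 h2 h3 h4 hω
    rw [h2, h3, h4, Set.indicator_of_mem hω] at h1
    simpa using h1
  · intro h
    filter_upwards [h, ae_smul (ind P hA) r, ae_smul (ind P hA) s, ae_ind hA] with ω h1 h2 h3 h4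
    rw [h2, h3, h4]
    by_cases hω : ω ∈ A
    · rw [h1 hω]
    · simp [Set.indicator_of_notMem hω]

theorem agreeOn_linearMap {A : Set Ω} {hA : MeasurableSet A} {f g : M →ₗ[L0 P] L0 P} :
    AgreeOn (P := P) hA f g ↔ ∀ x, AgreeOn (P := P) hA (f x) (g x) := by
  unfold AgreeOn
  rw [LinearMap.ext_iff]
  rfl

theorem agreeOn_pi {X : Type*} {A : Set Ω} {hA : MeasurableSet A} {f g : X → L0 P} :
    AgreeOn (P := P) hA f g ↔ ∀ x, AgreeOn (P := P) hA (f x) (g x) := by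
  unfold AgreeOn
  rw [funext_iff]
  rfl

theorem ind_mul_ind {A B : Set Ω} (hA : MeasurableSet A) (hB : MeasurableSet B) :
    ind P hA * ind P hB = ind P (hA.inter hB) := by
  rw [L0.eq_iff]
  filter_upwards [ae_mul (ind P hA) (ind P hB), ae_ind hA, ae_ind hB, ae_ind (hA.inter hB)]
    with ω h1 h2 h3 h4
  rw [h1, h2, h3, h4]
  by_cases ha : ω ∈ A <;> by_cases hb : ω ∈ B <;> simp [ha, hb]

theorem ind_congr {A B : Set Ω} (hA : MeasurableSet A) (hB : MeasurableSet B)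
    (h : ∀ᵐ ω ∂P, ω ∈ A ↔ ω ∈ B) : ind P hA = ind P hB := by
  rw [L0.eq_iff]
  filter_upwards [h, ae_ind hA, ae_ind hB] with ω h1 h2 h3
  rw [h2, h3]
  by_cases ha : ω ∈ A
  · simp [ha, h1.1 ha]
  · simp [ha, mt h1.2 ha]

theorem AgreeOn.mono {A B : Set Ω} {hA : MeasurableSet A} (hB : MeasurableSet B) {x y : M}
    (h : AgreeOn (P := P) hA x y) (hBA : ∀ᵐ ω ∂P, ω ∈ B → ω ∈ A) : AgreeOn (P := P) hB x y := by
  have h1 : ind P hB = ind P hB * ind P hA := by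
    rw [ind_mul_ind]
    refine ind_congr _ _ ?_
    filter_upwards [hBA] with ω hω
    exact ⟨fun hb => ⟨hb, hω hb⟩, fun hb => hb.1⟩
  unfold AgreeOn at *
  rw [h1, mul_smul, mul_smul, h]

/-- In a stable module, agreement may be checked on the parts of a partition. -/
theorem agreeOn_of_partition (hM : IsStableModule P M) {A : Set Ω} {hA : MeasurableSet A} {x y : M}
    (a : Partition Ω) (h : ∀ k, AgreeOn (P := P) (hA.inter (a.measurableSet k)) x y) :
    AgreeOn (P := P) hA x y := by
  -- The restrictions of `x` and `y` to `A` are both concatenations of the same sequence, so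
  -- uniqueness identifies them.
  obtain ⟨z, -, hz⟩ := hM a fun _ => ind P hA • x
  refine (hz _ fun k => rfl).trans (hz _ fun k => ?_).symm
  have := h k
  unfold AgreeOn at this
  rw [← ind_mul_ind, mul_comm, mul_smul, mul_smul] at this
  exact this.symm

/-- Concatenations of linear functionals exist. -/
theorem exists_glue_linearMap (a : Partition Ω) (f : ℕ → M →ₗ[L0 P] L0 P) :
    ∃ h : M →ₗ[L0 P] L0 P, ∀ k, AgreeOn (P := P) (a.measurableSet k) h (f k) := by
  have hex : ∀ x, ∃ s : L0 P, ∀ k, ∀ᵐ ω ∂P, ω ∈ a.part k → s ω = f k x ω :=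
    fun x => exists_glue_L0 a fun k => f k x
  choose h hh using hex
  refine ⟨{ toFun := h, map_add' := fun u v => ?_, map_smul' := fun r u => ?_ }, fun k => ?_⟩
  · refine L0.eq_iff.2 (a.ae_of_forall fun k => ?_)
    filter_upwards [hh (u + v) k, hh u k, hh v k, ae_add (h u) (h v), ae_add (f k u) (f k v)]
      with ω h1 h2 h3 h4 h5 hω
    rw [h4, h1 hω, h2 hω, h3 hω, map_add, h5]
  · refine L0.eq_iff.2 (a.ae_of_forall fun k => ?_)
    filter_upwards [hh (r • u) k, hh u k, ae_smul r (h u), ae_smul r (f k u)]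
      with ω h1 h2 h4 h5 hω
    rw [RingHom.id_apply, h4, h1 hω, h2 hω, LinearMap.map_smul, h5]
  · exact agreeOn_linearMap.2 fun x => agreeOn_L0.2 (hh x k)

/-- Concatenations of sequences in `X` exist in `X`. -/
def Glues (P : Measure Ω) {M : Type*} [AddCommGroup M] [Module (L0 P) M] (X : Set M) : Prop :=
  ∀ (a : Partition Ω) (x : ℕ → M), (∀ k, x k ∈ X) → ∃ y ∈ X, IsConcat P a x y

theorem IsStableSet.glues (hM : IsStableModule P M) {X : Set M} (hX : IsStableSet P X) :
    Glues P X := fun a x hx => by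
  obtain ⟨y, hy, -⟩ := hM a x
  exact ⟨y, hX.2 a x y hx hy, hy⟩

/-- Functions on `X` that are compatible with restriction to measurable sets. -/
def LocalOn (P : Measure Ω) {M : Type*} [AddCommGroup M] [Module (L0 P) M] (X : Set M)
    (φ : M → L0 P) : Prop :=
  ∀ (A : Set Ω) (hA : MeasurableSet A) (x y : M), x ∈ X → y ∈ X → AgreeOn (P := P) hA x y →
    ∀ᵐ ω ∂P, ω ∈ A → φ x ω = φ y ω

/-- Infima of local functions over sets that admit concatenations are almost attained. -/
theorem exists_almost_min [IsProbabilityMeasure P] {X : Set M} (hX : X.Nonempty)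
    (hglue : Glues P X) {φ : M → L0 P} (hφ : LocalOn P X φ) {b : L0 P}
    (hb : ∀ x ∈ X, b ≤ φ x) :
    ∃ g : L0 P, b ≤ g ∧ (∀ x ∈ X, g ≤ φ x) ∧ ∀ ε : L0 P, SLT P 0 ε → ∃ x ∈ X, φ x ≤ g + ε := by
  obtain ⟨g, hg, t, htT, ht⟩ := exists_isGLB_L0 (hX.image φ) (b := b)
    (by rintro _ ⟨x, hx, rfl⟩; exact hb x hx)
  refine ⟨g, hg.2 (by rintro _ ⟨x, hx, rfl⟩; exact hb x hx),
    fun x hx => hg.1 (Set.mem_image_of_mem φ hx), fun ε hε => ?_⟩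
  choose x hxX hxt using htT
  -- Where `t n` is within `ε` of the infimum, the `n`-th candidate is used; gluing gives one point
  -- good everywhere.
  obtain ⟨a, ha⟩ := exists_partition (P := P) (fun n => measurableSet_le_L0 (t n) (g + ε)) (by
    filter_upwards [ht, SLT_zero_iff.1 hε, ae_add g ε] with ω h1 h2 h3
    obtain ⟨n, hn⟩ := h1 _ h2
    exact ⟨n, by
      rw [h3]; exact hn.le⟩)
  obtain ⟨y, hy, hya⟩ := hglue a x hxX
  refine ⟨y, hy, L0.le_iff.2 (a.ae_of_forall fun k => ?_)⟩
  filter_upwards [ha k, hφ _ (a.measurableSet k) y (x k) hy (hxX k) (hya k)] with ω h1 h2 hω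
  rw [h2 hω, hxt k]
  exact h1 hω

theorem exists_almost_max [IsProbabilityMeasure P] {X : Set M} (hX : X.Nonempty)
    (hglue : Glues P X) {φ : M → L0 P} (hφ : LocalOn P X φ) {b : L0 P}
    (hb : ∀ x ∈ X, φ x ≤ b) :
    ∃ g : L0 P, (∀ x ∈ X, φ x ≤ g) ∧ ∀ ε : L0 P, SLT P 0 ε → ∃ x ∈ X, g ≤ φ x + ε := by
  obtain ⟨g, -, hg, hg'⟩ := exists_almost_min hX hglue (φ := fun x => -φ x) (b := -b) (by
    intro A hA x y hx hy h
    filter_upwards [hφ A hA x y hx hy h, ae_neg (φ x), ae_neg (φ y)] with ω h1 h2 h3 hω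
    rw [h2, h3, h1 hω]) (fun x hx => by
      rw [L0.le_iff]
      filter_upwards [L0.le_iff.1 (hb x hx), ae_neg b, ae_neg (φ x)] with ω h1 h2 h3
      linarith)
  refine ⟨-g, fun x hx => ?_, fun ε hε => ?_⟩
  · rw [L0.le_iff]
    filter_upwards [L0.le_iff.1 (hg x hx), ae_neg g, ae_neg (φ x)] with ω h1 h2 h3
    linarith
  · obtain ⟨x, hx, h⟩ := hg' ε hε
    refine ⟨x, hx, L0.le_iff.2 ?_⟩
    filter_upwards [L0.le_iff.1 h, ae_neg g, ae_neg (φ x), ae_add g ε, ae_add (φ x) ε]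
      with ω h1 h2 h3 h4 h5
    linarith

end Agree

/-! ### Stable topologies, and compactness implies attainment. -/

section Topology

variable {P : Measure Ω} {M : Type*} [AddCommGroup M] [Module (L0 P) M]

theorem isStableFinite_singleton {X : Type*} (p : X → L0 P) :
    IsStableFinite P ({p} : Set (X → L0 P)) := by
  refine ⟨⟨Set.singleton_nonempty p, fun a x y hx hy => ?_⟩, 1, fun _ => p, fun a n m _ _ _ k => rfl,
    ?_⟩
  · refine Set.mem_singleton_iff.2 (funext fun v => L0.eq_iff.2 (a.ae_of_forall fun k => ?_))
    have h1 := agreeOn_L0.1 (agreeOn_pi.1 (show AgreeOn (P := P) (a.measurableSet k) y (x k)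
      from hy k) v)
    rwa [Set.mem_singleton_iff.1 (hx k)] at h1
  · rw [Set.Icc_self]
    exact Set.bijOn_singleton.2 rfl

omit [Module (L0 P) M] in
theorem mem_basicNhd_singleton {p : M → L0 P} {x y : M} {r : L0 P} :
    y ∈ basicNhd P {p} x r ↔ ∀ᵐ ω ∂P, p (x - y) ω < r ω := by
  have h1 : (fun q : M → L0 P => q (x - y)) '' {p} = {p (x - y)} := Set.image_singleton
  change (∃ s, IsLUB ((fun q : M → L0 P => q (x - y)) '' {p}) s ∧ SLT P s r) ↔ _
  rw [h1]
  constructor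
  · rintro ⟨s, hs, hsr⟩
    rwa [← hs.unique isLUB_singleton]
  · intro h
    exact ⟨_, isLUB_singleton, h⟩

omit [Module (L0 P) M] in
theorem basicNhd_mem_nhds {Q : Set (M → L0 P)} {p : M → L0 P} (hp : p ∈ Q) (h0 : p 0 = 0) (x : M)
    {r : L0 P} (hr : SLT P 0 r) :
    {y | ∀ᵐ ω ∂P, p (x - y) ω < r ω} ∈ @nhds M (stableTopology P Q) x := by
  let _ : TopologicalSpace M := stableTopology P Q
  have h1 : IsOpen (basicNhd P {p} x r) := TopologicalSpace.isOpen_generateFrom_of_mem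
    ⟨{p}, x, r, by simpa using hp, isStableFinite_singleton p, hr, rfl⟩
  have h2 : x ∈ basicNhd P {p} x r := by
    rw [mem_basicNhd_singleton, sub_self, h0]
    exact hr
  filter_upwards [h1.mem_nhds h2] with y hy
  exact mem_basicNhd_singleton.1 hy

/-- The superlevel sets `U y` form a stable filter base on `S`, and a cluster point of it cannot
have a smaller value than any `y ∈ S`. -/
theorem isStableCompact_exists_isLUB {Q : Set (M → L0 P)} (hM : IsStableModule P M)
    {S : Set M} (hS : IsStableSet P S) (hc : IsStableCompact P (stableTopology P Q) S)
    (f : M →ₗ[L0 P] L0 P) (hf : (fun x => |f x|) ∈ Q) : ∃ y ∈ S, IsLUB (f '' S) (f y) := by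
  let U : M → Set M := fun y => {x | x ∈ S ∧ f y ≤ f x}
  have hU : ∀ y ∈ S, IsStableSet P (U y) := by
    intro y hy
    refine ⟨⟨y, hy, le_rfl⟩, fun a x z hx hz => ⟨hS.2 a x z (fun k => (hx k).1) hz, ?_⟩⟩
    refine L0.le_iff.2 (a.ae_of_forall fun k => ?_)
    have h1 := agreeOn_L0.1 (AgreeOn.map (show AgreeOn (P := P) (a.measurableSet k) z (x k)
      from hz k) f)
    filter_upwards [h1, L0.le_iff.1 (hx k).2] with ω h1 h2 hω
    rwa [h1 hω]
  have hUle : ∀ {y z x}, f y ≤ f z → x ∈ U z → x ∈ U y := fun h hx => ⟨hx.1, h.trans hx.2⟩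
  -- Gluing `y` and `z` according to which value is larger realises the pointwise maximum, so the
  -- sets `U y` are downward directed.
  have hdir : ∀ y ∈ S, ∀ z ∈ S, ∃ w ∈ S, f y ≤ f w ∧ f z ≤ f w := by
    intro y hy z hz
    obtain ⟨a, ha⟩ := exists_partition (P := P)
      (G := fun n => if n = 0 then {ω | f y ω ≤ f z ω} else {ω | f z ω ≤ f y ω}) (by
        intro n
        by_cases h : n = 0
        · simpa [h] using measurableSet_le_L0 (f y) (f z)
        · simpa [h] using measurableSet_le_L0 (f z) (f y)) (Filter.Eventually.of_forall fun ω => by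
        rcases le_total (f y ω) (f z ω) with h | h
        · exact ⟨0, by simpa using h⟩
        · exact ⟨1, by simpa using h⟩)
    obtain ⟨w, hw, hwa⟩ := hS.glues hM a (fun n => if n = 0 then z else y) (fun k => by
      by_cases h : k = 0 <;> simp [h, hy, hz])
    have h2 : ∀ᵐ ω ∂P, f y ω ≤ f w ω ∧ f z ω ≤ f w ω := by
      refine a.ae_of_forall fun k => ?_
      have h1 := agreeOn_L0.1 (AgreeOn.map (show AgreeOn (P := P) (a.measurableSet k) w _
        from hwa k) f)
      filter_upwards [h1, ha k] with ω h1 h2 hω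
      rw [h1 hω]
      have h3 := h2 hω
      by_cases h : k = 0
      · simp only [h, if_true] at h3 ⊢
        exact ⟨h3, le_rfl⟩
      · simp only [h, if_false] at h3 ⊢
        exact ⟨le_rfl, h3⟩
    exact ⟨w, hw, L0.le_iff.2 (h2.mono fun _ h => h.1), L0.le_iff.2 (h2.mono fun _ h => h.2)⟩
  obtain ⟨y₀, hy₀⟩ := hS.1
  let F : Filter M :=
    { sets := {V | ∃ y ∈ S, U y ⊆ V}
      univ_sets := ⟨y₀, hy₀, Set.subset_univ _⟩
      sets_of_superset := fun ⟨y, hy, h⟩ h' => ⟨y, hy, h.trans h'⟩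
      inter_sets := by
        rintro V W ⟨y, hy, h⟩ ⟨z, hz, h'⟩
        obtain ⟨w, hw, h1, h2⟩ := hdir y hy z hz
        exact ⟨w, hw, fun x hx => ⟨h (hUle h1 hx), h' (hUle h2 hx)⟩⟩ }
  have hF : IsStableFilterOn P S F := by
    refine ⟨U '' S, ⟨⟨_, Set.mem_image_of_mem U hy₀⟩, ?_, ?_⟩, ?_, ?_⟩
    · rintro _ ⟨y, hy, rfl⟩
      exact hU y hy
    · intro a Y hY
      choose y hyS hyY using hY
      obtain ⟨z, hz, hza⟩ := hS.glues hM a y hyS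
      refine ⟨z, hz, Set.ext fun x => ⟨fun hx => ?_, ?_⟩⟩
      · have h1 : ∀ k, ∃ v ∈ U (y k), AgreeOn (P := P) (a.measurableSet k) x v := by
          intro k
          -- Membership in `U (y k)` is global, but `x` dominates `y k` only on part `k`; elsewhere
          -- `x` is replaced by `y k` itself.
          obtain ⟨v, hv, hva⟩ := hS.glues hM a (fun j => if j = k then x else y k) (fun j => by
            by_cases h : j = k <;> simp [h, hx.1, hyS k])
          have hva' : ∀ j, AgreeOn (P := P) (a.measurableSet j) v (if j = k then x else y k) := hva
          refine ⟨v, ⟨hv, L0.le_iff.2 (a.ae_of_forall fun j => ?_)⟩, ?_⟩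
          · have h2 := agreeOn_L0.1 ((hva' j).map f)
            by_cases h : j = k
            · subst h
              simp only [if_true] at h2
              filter_upwards [h2, L0.le_iff.1 hx.2, agreeOn_L0.1 (AgreeOn.map
                (show AgreeOn (P := P) (a.measurableSet j) z (y j) from hza j) f)]
                with ω h3 h4 h5 hω
              rw [h3 hω, ← h5 hω]
              exact h4
            · simp only [h, if_false] at h2
              filter_upwards [h2] with ω h3 hω
              rw [h3 hω]
          · simpa using (hva' k).symm
        choose v hv hvx using h1
        exact ⟨v, fun k => hyY k ▸ hv k, hvx⟩
      · rintro ⟨v, hv, hva⟩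
        have hv' : ∀ k, v k ∈ U (y k) := fun k => by rw [hyY k]; exact hv k
        refine ⟨hS.2 a v x (fun k => (hv' k).1) hva, L0.le_iff.2 (a.ae_of_forall fun k => ?_)⟩
        filter_upwards [agreeOn_L0.1 (AgreeOn.map
          (show AgreeOn (P := P) (a.measurableSet k) x (v k) from hva k) f),
          agreeOn_L0.1 (AgreeOn.map (show AgreeOn (P := P) (a.measurableSet k) z (y k)
          from hza k) f), L0.le_iff.1 (hv' k).2] with ω h1 h2 h3 hω
        rw [h1 hω, h2 hω]
        exact h3
    · rintro _ ⟨y, hy, rfl⟩ x hx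
      exact hx.1
    · intro V
      constructor
      · rintro ⟨y, hy, h⟩
        exact ⟨_, Set.mem_image_of_mem U hy, h⟩
      · rintro ⟨_, ⟨y, hy, rfl⟩, h⟩
        exact ⟨y, hy, h⟩
  obtain ⟨x, hxS, hx⟩ := hc F hF
  refine ⟨x, hxS, ?_, fun b hb => hb (Set.mem_image_of_mem f hxS)⟩
  rintro _ ⟨y, hy, rfl⟩
  -- The radius is the gap between the values where `x` falls short of `y`. A point of `U y` within
  -- that radius of `x` is impossible there; the value `1` elsewhere only keeps `r` positive.
  obtain ⟨r, hr⟩ := exists_L0 (P := P) (φ := fun ω => if f x ω < f y ω then f y ω - f x ω else 1)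
    (Measurable.ite (measurableSet_lt (f x).measurable (f y).measurable)
      ((f y).measurable.sub (f x).measurable) measurable_const)
  have hr0 : SLT P 0 r := by
    rw [SLT_zero_iff]
    filter_upwards [hr] with ω h
    rw [h]
    split_ifs with h'
    · linarith
    · exact one_pos
  have h1 := basicNhd_mem_nhds hf (by simp) x hr0
  have h2 : U y ∈ F := ⟨y, hy, subset_rfl⟩
  let _ : TopologicalSpace M := stableTopology P Q
  have h3 : (nhds x ⊓ F).NeBot := hx
  obtain ⟨w, hw1, hw2⟩ := h3.nonempty_of_mem (Filter.inter_mem_inf h1 h2)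
  have hsub : ∀ᵐ ω ∂P, f (x - w) ω = f x ω - f w ω := by rw [map_sub]; exact ae_sub _ _
  rw [L0.le_iff]
  filter_upwards [hw1, hr, L0.le_iff.1 hw2.2, ae_abs (f (x - w)),
    hsub] with ω h3 h4 h5 h6 h7
  by_contra h8
  rw [not_le] at h8
  rw [h6, h7, h4, if_pos h8] at h3
  have := (abs_lt.1 h3).1
  linarith

end Topology

/-! ### The norm, bounded functionals and the dual ball. -/

namespace L0Norm

variable {P : Measure Ω} {E : Type*} [AddCommGroup E] [Module (L0 P) E] (N : L0Norm P E)

theorem ae_nonneg (x : E) : ∀ᵐ ω ∂P, 0 ≤ N.toFun x ω := L0.nonneg_iff.1 (N.nonneg x)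

theorem ae_norm_smul (r : L0 P) (x : E) :
    ∀ᵐ ω ∂P, N.toFun (r • x) ω = |r ω| * N.toFun x ω := by
  rw [N.map_smul]
  filter_upwards [ae_mul |r| (N.toFun x), ae_abs r] with ω h1 h2
  rw [h1, h2]

theorem ae_norm_add (x y : E) : ∀ᵐ ω ∂P, N.toFun (x + y) ω ≤ N.toFun x ω + N.toFun y ω := by
  filter_upwards [L0.le_iff.1 (N.add_le x y), ae_add (N.toFun x) (N.toFun y)] with ω h1 h2
  linarith

theorem norm_zero : N.toFun 0 = 0 := by
  have := N.map_smul 0 0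
  rwa [zero_smul, abs_zero, zero_mul] at this

theorem norm_neg (x : E) : N.toFun (-x) = N.toFun x := by
  have := N.map_smul (-1) x
  rw [neg_smul, one_smul, abs_neg] at this
  rw [this, L0.eq_iff]
  filter_upwards [ae_mul |1| (N.toFun x), ae_abs (1 : L0 P), ae_one (P := P)] with ω h1 h2 h3
  rw [h1, h2, h3]
  simp

theorem norm_agree {A : Set Ω} {hA : MeasurableSet A} {x y : E} (h : AgreeOn (P := P) hA x y) :
    ∀ᵐ ω ∂P, ω ∈ A → N.toFun x ω = N.toFun y ω := by
  have h1 : N.toFun (ind P hA • x) = N.toFun (ind P hA • y) := congrArg _ h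
  filter_upwards [N.ae_norm_smul (ind P hA) x, N.ae_norm_smul (ind P hA) y, ae_ind (P := P) hA]
    with ω h2 h3 h4 hω
  rw [h1, h3, h4, Set.indicator_of_mem hω] at h2
  simpa using h2.symm

theorem bound_of_bound_on_ball (f : E →ₗ[L0 P] L0 P) {K r : L0 P} (hr : SLT P 0 r)
    (h : ∀ x, (∀ᵐ ω ∂P, N.toFun x ω < r ω) → |f x| ≤ K) (x : E) :
    ∀ᵐ ω ∂P, |f x ω| ≤ K ω / r ω * N.toFun x ω := by
  have h1 : ∀ n : ℕ, ∀ᵐ ω ∂P, |f x ω| ≤ K ω / r ω * (N.toFun x ω + 1 / ((n : ℝ) + 1)) := by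
    intro n
    obtain ⟨t, ht⟩ := exists_L0 (P := P)
      -- This factor scales `x` strictly inside the ball of radius `r`. The term `1 / (n + 1)`
      -- permits the norm to vanish on part of `Ω` and disappears in the limit.
      (φ := fun ω => r ω / (N.toFun x ω + 1 / ((n : ℝ) + 1)))
      (r.measurable.div ((N.toFun x).measurable.add_const _))
    have hpos : (0 : ℝ) < 1 / ((n : ℝ) + 1) := by positivity
    have h2 := h (t • x) (by
      filter_upwards [N.ae_norm_smul t x, ht, SLT_zero_iff.1 hr, N.ae_nonneg x] with ω h1 h2 h3 h4
      rw [h1, h2, abs_of_nonneg (by positivity), div_mul_eq_mul_div, div_lt_iff₀ (by positivity)]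
      nlinarith)
    filter_upwards [L0.abs_le_iff.1 h2, ht, SLT_zero_iff.1 hr, N.ae_nonneg x, (by
      rw [LinearMap.map_smul]; exact ae_smul _ _ : ∀ᵐ ω ∂P, f (t • x) ω = t ω * f x ω)]
      with ω h1 h2 h3 h4 h5
    rw [h5, h2, abs_mul, abs_of_nonneg (by positivity), div_mul_eq_mul_div,
      div_le_iff₀ (by positivity)] at h1
    rw [div_mul_eq_mul_div, le_div_iff₀ h3]
    linarith
  filter_upwards [ae_all_iff.2 h1] with ω hω
  have h3 : Filter.Tendsto (fun n : ℕ => K ω / r ω * (N.toFun x ω + 1 / ((n : ℝ) + 1)))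
      Filter.atTop (nhds (K ω / r ω * (N.toFun x ω + 0))) :=
    (tendsto_one_div_add_atTop_nhds_zero_nat.const_add _).const_mul _
  rw [add_zero] at h3
  exact ge_of_tendsto' h3 hω

/-- A nonempty subset of a one-element family of seminorms is that family, so the generating sets
are plain balls and the triangle inequality applies. -/
theorem exists_ball_subset {U : Set E} (hU : @IsOpen E N.topology U) :
    ∀ x ∈ U, ∃ r : L0 P, SLT P 0 r ∧ ∀ y, (∀ᵐ ω ∂P, N.toFun (x - y) ω < r ω) → y ∈ U := by
  induction hU with
  | basic U hU =>
    intro x hx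
    obtain ⟨N', c, r, hN', hfin, hr, rfl⟩ := hU
    have hN : N' = {N.toFun} := (Set.subset_singleton_iff_eq.1 hN').resolve_left
      hfin.1.1.ne_empty
    subst hN
    rw [mem_basicNhd_singleton] at hx
    refine ⟨r - N.toFun (c - x), ?_, fun y hy => ?_⟩
    · rw [SLT_zero_iff]
      filter_upwards [hx, ae_sub r (N.toFun (c - x))] with ω h1 h2
      rw [h2]; linarith
    · rw [mem_basicNhd_singleton]
      have h3 := N.ae_norm_add (c - x) (x - y)
      rw [sub_add_sub_cancel] at h3
      filter_upwards [hy, ae_sub r (N.toFun (c - x)), h3] with ω h1 h2 h3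
      linarith
  | univ =>
    intro x _
    obtain ⟨r, hr, -⟩ := exists_pos_const P one_pos
    exact ⟨r, hr, fun _ _ => trivial⟩
  | inter U V _ _ hU hV =>
    intro x hx
    obtain ⟨r, hr, h⟩ := hU x hx.1
    obtain ⟨s, hs, h'⟩ := hV x hx.2
    refine ⟨r ⊓ s, ?_, fun y hy => ⟨h y ?_, h' y ?_⟩⟩
    · rw [SLT_zero_iff] at *
      filter_upwards [hr, hs, AEEqFun.coeFn_inf r s] with ω h1 h2 h3
      rw [h3]; exact lt_min h1 h2
    · filter_upwards [hy, AEEqFun.coeFn_inf r s] with ω h1 h3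
      rw [h3] at h1; exact (lt_min_iff.1 h1).1
    · filter_upwards [hy, AEEqFun.coeFn_inf r s] with ω h1 h3
      rw [h3] at h1; exact (lt_min_iff.1 h1).2
  | sUnion C _ hC =>
    rintro x ⟨U, hU, hx⟩
    obtain ⟨r, hr, h⟩ := hC U hU x hx
    exact ⟨r, hr, fun y hy => ⟨U, hU, h y hy⟩⟩

/-- Continuity of linear functions is boundedness. -/
theorem mem_dual_iff {f : E →ₗ[L0 P] L0 P} :
    f ∈ N.dual ↔ ∃ C : L0 P, ∀ x, ∀ᵐ ω ∂P, |f x ω| ≤ C ω * N.toFun x ω := by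
  constructor
  · intro hf
    obtain ⟨e, he, he1⟩ := exists_pos_const P one_pos
    have h1 := basicNhd_mem_nhds (Q := {fun r : L0 P => |r|}) (Set.mem_singleton _) abs_zero 0 he
    obtain ⟨U, hU, hUo, h0⟩ := (@mem_nhds_iff (L0 P)
      (stableTopology P {fun r : L0 P => |r|}) _ _).1 h1
    have h2 : @IsOpen E N.topology (f ⁻¹' U) :=
      @IsOpen.preimage _ _ N.topology (stableTopology P {fun r : L0 P => |r|}) _ hf _ hUo
    obtain ⟨r, hr, h3⟩ := N.exists_ball_subset h2 0 (by simpa using h0)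
    obtain ⟨C, hC⟩ := exists_L0 (P := P) (e.measurable.div r.measurable)
    refine ⟨C, fun x => ?_⟩
    have h7 := N.bound_of_bound_on_ball f (K := e) hr (fun y hy => by
      have h6 := hU (h3 y (by rwa [zero_sub, N.norm_neg]))
      simp only [zero_sub, abs_neg] at h6
      exact L0.le_iff.2 (Filter.Eventually.mono h6 fun ω h => le_of_lt h)) x
    filter_upwards [hC, h7] with ω h4 h5
    rw [h4]
    exact h5
  · rintro ⟨C, hC⟩
    let _ := N.topology
    refine continuous_generateFrom_iff.2 ?_
    rintro _ ⟨N', c, r, hN', hfin, hr, rfl⟩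
    have hN : N' = {fun r : L0 P => |r|} := (Set.subset_singleton_iff_eq.1 hN').resolve_left
      hfin.1.1.ne_empty
    subst hN
    rw [isOpen_iff_mem_nhds]
    intro x hx
    rw [Set.mem_preimage, mem_basicNhd_singleton] at hx
    obtain ⟨s, hs⟩ := exists_L0 (P := P)
      -- The room left in the target ball, divided by a strictly positive bound for `f`.
      (φ := fun ω => (r ω - |(c - f x) ω|) / (|C ω| + 1))
      ((r.measurable.sub (c - f x).measurable.abs).div (C.measurable.abs.add_const _))
    have hs0 : SLT P 0 s := by
      rw [SLT_zero_iff]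
      filter_upwards [hx, hs, ae_abs (c - f x)] with ω h1 h2 h3
      rw [h2]
      have : 0 < r ω - |(c - f x) ω| := by linarith
      positivity
    filter_upwards [basicNhd_mem_nhds (Q := {N.toFun}) (Set.mem_singleton _) N.norm_zero x hs0]
      with y hy
    rw [Set.mem_preimage, mem_basicNhd_singleton]
    have hxy : ∀ᵐ ω ∂P, f (x - y) ω = f x ω - f y ω := by rw [map_sub]; exact ae_sub _ _
    filter_upwards [hy, hs, hC (x - y), hxy, ae_abs (c - f y), ae_sub c (f y), ae_sub c (f x),
      N.ae_nonneg (x - y)] with ω h1 h2 h3 h4 h5 h6 h7 h8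
    rw [h2, lt_div_iff₀ (by positivity), h7] at h1
    rw [h5, h6]
    rw [h4] at h3
    have h9 := abs_sub_le (c ω) (f x ω) (f y ω)
    have h10 := mul_le_mul_of_nonneg_right (le_abs_self (C ω)) h8
    linarith

theorem mem_dualBall_iff [IsProbabilityMeasure P] {f : E →ₗ[L0 P] L0 P} :
    f ∈ N.dualBall ↔ ∀ x, ∀ᵐ ω ∂P, |f x ω| ≤ N.toFun x ω := by
  constructor
  · rintro ⟨-, s, hs, hs1⟩ x
    obtain ⟨e, he, he1⟩ := exists_pos_const P one_pos
    have h4 := N.bound_of_bound_on_ball f (K := 1) he (fun y hy => by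
      refine (hs.1 ⟨y, ?_, rfl⟩).trans hs1
      rw [L0.le_iff]
      filter_upwards [he1, hy, ae_one (P := P)] with ω h1 h2 h3
      linarith) x
    filter_upwards [he1, h4, ae_one (P := P)] with ω h1 h2 h3
    rw [h1, h3] at h2
    simpa using h2
  · intro h
    refine ⟨N.mem_dual_iff.2 ⟨1, fun x => ?_⟩, ?_⟩
    · filter_upwards [h x, ae_one (P := P)] with ω h1 h2
      rw [h2]; simpa using h1
    · have hb : ∀ t ∈ {r | ∃ x : E, N.toFun x ≤ 1 ∧ r = |f x|}, t ≤ 1 := by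
        rintro _ ⟨x, hx, rfl⟩
        refine le_trans ?_ hx
        exact L0.abs_le_iff.2 (h x)
      obtain ⟨s, hs⟩ := exists_isLUB_L0 (T := {r | ∃ x : E, N.toFun x ≤ 1 ∧ r = |f x|})
        ⟨_, 0, by
          rw [N.norm_zero, L0.le_iff]
          filter_upwards [ae_zero (P := P), ae_one (P := P)] with ω h1 h2
          rw [h1, h2]; exact zero_le_one, rfl⟩ hb
      exact ⟨s, hs, hs.2 hb⟩

theorem dual_add {f g : E →ₗ[L0 P] L0 P} (hf : f ∈ N.dual) (hg : g ∈ N.dual) :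
    f + g ∈ N.dual := by
  rw [mem_dual_iff] at *
  obtain ⟨C, hC⟩ := hf
  obtain ⟨D, hD⟩ := hg
  refine ⟨C + D, fun x => ?_⟩
  filter_upwards [hC x, hD x, ae_add (f x) (g x), ae_add C D] with ω h1 h2 h3 h4
  rw [LinearMap.add_apply, h3, h4, add_mul]
  exact (abs_add_le _ _).trans (add_le_add h1 h2)

theorem dual_smul {f : E →ₗ[L0 P] L0 P} (r : L0 P) (hf : f ∈ N.dual) : r • f ∈ N.dual := by
  rw [mem_dual_iff] at *
  obtain ⟨C, hC⟩ := hf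
  refine ⟨|r| * C, fun x => ?_⟩
  filter_upwards [hC x, ae_smul r (f x), ae_mul |r| C, ae_abs r] with ω h1 h2 h3 h4
  rw [LinearMap.smul_apply, h2, h3, h4, abs_mul, mul_assoc]
  exact mul_le_mul_of_nonneg_left h1 (abs_nonneg _)

theorem dual_neg {f : E →ₗ[L0 P] L0 P} (hf : f ∈ N.dual) : -f ∈ N.dual := by
  have := N.dual_smul (-1) hf
  rwa [neg_smul, one_smul] at this

theorem dual_sub {f g : E →ₗ[L0 P] L0 P} (hf : f ∈ N.dual) (hg : g ∈ N.dual) :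
    f - g ∈ N.dual := by
  rw [sub_eq_add_neg]
  exact N.dual_add hf (N.dual_neg hg)

theorem dual_zero : (0 : E →ₗ[L0 P] L0 P) ∈ N.dual :=
  N.mem_dual_iff.2 ⟨0, fun x => by
    filter_upwards [ae_zero (P := P)] with ω h
    rw [LinearMap.zero_apply, h]; simp⟩

/-- Sums of norm-summable series of linear functions. -/
theorem exists_hasSum (y : ℕ → E →ₗ[L0 P] L0 P) {c : ℕ → ℝ} (hc : Summable c)
    (hy : ∀ k x, ∀ᵐ ω ∂P, |y k x ω| ≤ c k * N.toFun x ω) :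
    ∃ h : E →ₗ[L0 P] L0 P, ∀ x, ∀ᵐ ω ∂P, HasSum (fun k => y k x ω) (h x ω) := by
  have hsum : ∀ x, ∀ᵐ ω ∂P, Summable fun k => y k x ω := by
    intro x
    filter_upwards [ae_all_iff.2 fun k => hy k x] with ω hω
    exact Summable.of_norm_bounded (hc.mul_right (N.toFun x ω)) hω
  have hex : ∀ x, ∃ r : L0 P, ∀ᵐ ω ∂P, HasSum (fun k => y k x ω) (r ω) := by
    intro x
    have h1 : AEStronglyMeasurable (fun ω => ∑' k, y k x ω) P := by
      refine aestronglyMeasurable_of_tendsto_ae Filter.atTop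
        (f := fun (n : ℕ) ω => ∑ k ∈ Finset.range n, y k x ω) (fun n => ?_) ?_
      · exact (Finset.measurable_fun_sum _ fun k _ => (y k x).measurable).aestronglyMeasurable
      · filter_upwards [hsum x] with ω hω
        exact hω.hasSum.tendsto_sum_nat
    refine ⟨AEEqFun.mk _ h1, ?_⟩
    filter_upwards [hsum x, AEEqFun.coeFn_mk _ h1] with ω h2 h3
    rw [h3]
    exact h2.hasSum
  choose h hh using hex
  refine ⟨{ toFun := h, map_add' := fun u v => ?_, map_smul' := fun r u => ?_ }, hh⟩
  · rw [L0.eq_iff]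
    filter_upwards [hh (u + v), hh u, hh v, ae_all_iff.2 fun k => ae_add (y k u) (y k v),
      ae_add (h u) (h v)] with ω h1 h2 h3 h4 h5
    rw [h5]
    refine h1.unique ?_
    have h6 := h2.add h3
    simp_rw [map_add, h4]
    exact h6
  · rw [L0.eq_iff]
    filter_upwards [hh (r • u), hh u, ae_all_iff.2 fun k => ae_smul r (y k u),
      ae_smul r (h u)] with ω h1 h2 h4 h5
    rw [RingHom.id_apply, h5]
    refine h1.unique ?_
    have h6 := h2.mul_left (r ω)
    simp_rw [LinearMap.map_smul, h4]
    exact h6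

theorem glues_dualBall [IsProbabilityMeasure P] : Glues P N.dualBall := by
  intro a f hf
  obtain ⟨h, hh⟩ := exists_glue_linearMap a f
  refine ⟨h, N.mem_dualBall_iff.2 fun x => a.ae_of_forall fun k => ?_, hh⟩
  filter_upwards [agreeOn_L0.1 (agreeOn_linearMap.1 (hh k) x), N.mem_dualBall_iff.1 (hf k) x]
    with ω h1 h2 hω
  rw [h1 hω]
  exact h2

end L0Norm

/-! ### Hahn–Banach, norming functionals and uniform boundedness. -/

section HahnBanach

variable {P : Measure Ω} {E : Type*} [AddCommGroup E] [Module (L0 P) E]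

/-- Sublinear functions with values in `L⁰`. -/
structure IsSublinear (p : E → L0 P) : Prop where
  add_le : ∀ x y, p (x + y) ≤ p x + p y
  smul_le : ∀ (r : L0 P) (x : E), 0 ≤ r → p (r • x) ≤ r * p x

theorem IsSublinear.map_zero {p : E → L0 P} (hp : IsSublinear p) : p 0 = 0 := by
  refine le_antisymm ?_ ?_
  · have := hp.smul_le 0 0 le_rfl
    rwa [zero_smul, zero_mul] at this
  · have := hp.add_le 0 0
    rw [add_zero] at this
    exact (le_add_iff_nonneg_left _).1 this

theorem IsSublinear.neg_le {p : E → L0 P} (hp : IsSublinear p) (x : E) : -p (-x) ≤ p x := by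
  have := hp.add_le x (-x)
  rw [add_neg_cancel, hp.map_zero] at this
  exact neg_le_iff_add_nonneg.2 this

/-- Since `t` may vanish on part of `Ω`, the inverse of `1 + t` is used: `(1 + t) p y ≤ p (y + t y)
≤ p y + p (t y)`. -/
theorem IsSublinear.map_smul {p : E → L0 P} (hp : IsSublinear p) {t : L0 P} (ht : 0 ≤ t) (y : E) :
    p (t • y) = t * p y := by
  refine le_antisymm (hp.smul_le t y ht) ?_
  obtain ⟨s, hs⟩ := exists_L0 (P := P) ((t.measurable.const_add 1).inv)
  have h1 : s * (1 + t) = 1 := by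
    rw [L0.eq_iff]
    filter_upwards [hs, ae_mul s (1 + t), ae_add 1 t, ae_one (P := P), L0.nonneg_iff.1 ht]
      with ω h1 h2 h3 h4 h5
    rw [h2, h1, h3, h4]
    simp only [Pi.inv_apply]
    field_simp
  have hs0 : 0 ≤ s := by
    rw [L0.nonneg_iff]
    filter_upwards [hs, L0.nonneg_iff.1 ht] with ω h1 h2
    rw [h1]
    simp only [Pi.inv_apply]
    positivity
  have h2 := hp.smul_le s ((1 + t) • y) hs0
  rw [smul_smul, h1, one_smul, add_smul, one_smul] at h2
  have h3 := hp.add_le y (t • y)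
  rw [L0.le_iff]
  filter_upwards [L0.le_iff.1 h2, L0.le_iff.1 h3, ae_mul s (p (y + t • y)), hs,
    L0.nonneg_iff.1 ht, ae_add (p y) (p (t • y)), ae_mul t (p y)] with ω h4 h5 h6 h7 h8 h9 h10
  rw [h6, h7, Pi.inv_apply, inv_mul_eq_div, le_div_iff₀ (by positivity)] at h4
  rw [h10]
  linarith

variable [IsProbabilityMeasure P]

/-- As `r` may vanish on part of `Ω`, one cannot divide by it; the infimum is approached pointwise
by a sequence instead. -/
theorem le_mul_of_isGLB {T : Set (L0 P)} (hT : T.Nonempty) {g r u : L0 P} (hg : IsGLB T g)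
    (hr : 0 ≤ r) (h : ∀ t ∈ T, u ≤ r * t) : u ≤ r * g := by
  obtain ⟨g', hg', t, htT, ht⟩ := exists_isGLB_L0 hT hg.1
  rw [hg.unique hg', L0.le_iff]
  filter_upwards [ht, ae_all_iff.2 fun n => L0.le_iff.1 (h _ (htT n)),
    ae_all_iff.2 fun n => ae_mul r (t n), ae_mul r g', L0.nonneg_iff.1 hr] with ω h1 h2 h3 h4 h5
  rw [h4]
  refine le_of_forall_pos_le_add fun ε hε => ?_
  obtain ⟨n, hn⟩ := h1 (ε / (r ω + 1)) (by positivity)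
  have h6 := h2 n
  rw [h3] at h6
  have h7 : r ω * (ε / (r ω + 1)) ≤ ε := by
    rw [mul_div_assoc', div_le_iff₀ (by positivity)]
    nlinarith
  nlinarith [mul_le_mul_of_nonneg_left hn.le h5]

omit [IsProbabilityMeasure P] in
theorem le_add_of_isGLB {T T' : Set (L0 P)} {g g' u : L0 P} (hg : IsGLB T g) (hg' : IsGLB T' g')
    (h : ∀ t ∈ T, ∀ t' ∈ T', u ≤ t + t') : u ≤ g + g' := by
  rw [← sub_le_iff_le_add]
  refine hg.2 fun t ht => ?_
  rw [sub_le_iff_le_add, ← sub_le_iff_le_add']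
  exact hg'.2 fun t' ht' => sub_le_iff_le_add'.2 (h t ht t' ht')

/-- A sublinear function can be lowered so as to become linear in the direction `y`. -/
theorem IsSublinear.exists_shift {p : E → L0 P} (hp : IsSublinear p) (y : E) :
    ∃ q : E → L0 P, IsSublinear q ∧ (∀ x, q x ≤ p x) ∧ ∀ x, q x ≤ p (x + y) - p y := by
  have hne : ∀ x, (Set.image (fun t => p (x + t • y) - t * p y) {t | 0 ≤ t}).Nonempty :=
    fun x => Set.Nonempty.image _ ⟨0, le_refl (0 : L0 P)⟩
  -- The lower bound comes from `t p y = p (t y) ≤ p (-x) + p (x + t y)`.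
  have hb : ∀ x, ∃ g, IsGLB (Set.image (fun t => p (x + t • y) - t * p y) {t | 0 ≤ t}) g := by
    intro x
    obtain ⟨g, hg, -⟩ := exists_isGLB_L0 (hne x) (b := -p (-x)) (by
      rintro _ ⟨t, ht, rfl⟩
      have h1 := hp.add_le (-x) (x + t • y)
      rw [neg_add_cancel_left, hp.map_smul ht] at h1
      rw [le_sub_iff_add_le, neg_add_le_iff_le_add]
      exact h1)
    exact ⟨g, hg⟩
  choose q hq using hb
  refine ⟨q, ⟨fun x x' => ?_, fun r x hr => ?_⟩, fun x => ?_, fun x => ?_⟩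
  · refine le_add_of_isGLB (hq x) (hq x') ?_
    rintro _ ⟨t, ht, rfl⟩ _ ⟨t', ht', rfl⟩
    refine ((hq (x + x')).1 ⟨t + t', Set.mem_ofPred.2 (add_nonneg ht ht'), rfl⟩).trans ?_
    have h1 := hp.add_le (x + t • y) (x' + t' • y)
    have h2 : x + t • y + (x' + t' • y) = x + x' + (t + t') • y := by rw [add_smul]; abel
    rw [h2] at h1
    have h3 : p (x + t • y) - t * p y + (p (x' + t' • y) - t' * p y) =
      p (x + t • y) + p (x' + t' • y) - (t + t') * p y := by ring
    simp only
    rw [h3]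
    exact sub_le_sub_right h1 _
  · refine le_mul_of_isGLB (hne x) (hq x) hr ?_
    rintro _ ⟨t, ht, rfl⟩
    have hrt : 0 ≤ r * t := by
      rw [L0.nonneg_iff] at *
      filter_upwards [hr, L0.nonneg_iff.1 ht, ae_mul r t] with ω h1 h2 h3
      rw [h3]; positivity
    refine ((hq (r • x)).1 ⟨r * t, hrt, rfl⟩).trans ?_
    have h1 := hp.smul_le r (x + t • y) hr
    rw [smul_add, smul_smul] at h1
    simp only
    rw [mul_sub, ← mul_assoc]
    exact sub_le_sub_right h1 _
  · refine (hq x).1 ⟨0, Set.mem_ofPred.2 le_rfl, ?_⟩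
    simp
  · refine (hq x).1 ⟨1, ?_, ?_⟩
    · change (0 : L0 P) ≤ 1
      rw [L0.nonneg_iff]
      filter_upwards [ae_one (P := P)] with ω h
      rw [h]; exact zero_le_one
    · simp

/-- Every sublinear function dominates a linear function. -/
theorem IsSublinear.exists_linearMap_le {p₀ : E → L0 P} (hp₀ : IsSublinear p₀) :
    ∃ f : E →ₗ[L0 P] L0 P, ∀ x, f x ≤ p₀ x := by
  -- A minimal sublinear function is linear; the order dual turns the search for it into one for a
  -- maximal element.
  obtain ⟨p, hpm⟩ := zorn_le₀ (α := (E → L0 P)ᵒᵈ)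
    {p | IsSublinear (OrderDual.ofDual p) ∧ OrderDual.ofDual p ≤ p₀} (by
    intro c hc hchain
    rcases c.eq_empty_or_nonempty with rfl | ⟨p₁, hp₁⟩
    · exact ⟨OrderDual.toDual p₀, ⟨hp₀, le_rfl⟩, by simp⟩
    have hne : ∀ x, ((fun p : (E → L0 P)ᵒᵈ => OrderDual.ofDual p x) '' c).Nonempty :=
      fun x => ⟨_, p₁, hp₁, rfl⟩
    have hb : ∀ x, ∃ g, IsGLB ((fun p : (E → L0 P)ᵒᵈ => OrderDual.ofDual p x) '' c) g := by
      intro x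
      obtain ⟨g, hg, -⟩ := exists_isGLB_L0 (hne x) (b := -p₀ (-x)) (by
        rintro _ ⟨p, hp, rfl⟩
        exact (neg_le_neg ((hc hp).2 (-x))).trans ((hc hp).1.neg_le x))
      exact ⟨g, hg⟩
    choose q hq using hb
    refine ⟨OrderDual.toDual q, ⟨⟨fun x y => ?_, fun r x hr => ?_⟩, fun x => ?_⟩, fun p hp => ?_⟩
    · refine le_add_of_isGLB (hq x) (hq y) ?_
      rintro _ ⟨p, hp, rfl⟩ _ ⟨p', hp', rfl⟩
      have key : ∀ m ∈ c, OrderDual.ofDual m ≤ OrderDual.ofDual p →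
          OrderDual.ofDual m ≤ OrderDual.ofDual p' →
          q (x + y) ≤ OrderDual.ofDual p x + OrderDual.ofDual p' y := fun m hm h h' =>
        ((hq (x + y)).1 ⟨m, hm, rfl⟩).trans (((hc hm).1.add_le x y).trans
          (add_le_add (h x) (h' y)))
      rcases hchain.total hp hp' with h | h
      · exact key p' hp' h le_rfl
      · exact key p hp le_rfl h
    · refine le_mul_of_isGLB (hne x) (hq x) hr ?_
      rintro _ ⟨p, hp, rfl⟩
      exact ((hq (r • x)).1 ⟨p, hp, rfl⟩).trans ((hc hp).1.smul_le r x hr)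
    · exact ((hq x).1 ⟨p₁, hp₁, rfl⟩).trans ((hc hp₁).2 x)
    · exact fun x => (hq x).1 ⟨p, hp, rfl⟩)
  set p' : E → L0 P := OrderDual.ofDual p with hp'
  have hp : IsSublinear p' := hpm.1.1
  have hmin : ∀ q : E → L0 P, IsSublinear q → q ≤ p' → p' ≤ q := fun q hq hqp =>
    hpm.2 (y := OrderDual.toDual q) ⟨hq, hqp.trans hpm.1.2⟩ hqp
  have hadd : ∀ x y, p' (x + y) = p' x + p' y := by
    intro x y
    refine le_antisymm (hp.add_le x y) ?_
    -- By minimality the lowered function is still `p'`, which gives `p' x ≤ p' (x + y) - p' y`.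
    obtain ⟨q, hq, hqp, hqy⟩ := hp.exists_shift y
    have h1 := (hmin q hq hqp x).trans (hqy x)
    exact le_sub_iff_add_le.1 h1
  have hneg : ∀ x, p' (-x) = -p' x := fun x => by
    rw [eq_neg_iff_add_eq_zero, ← hadd, neg_add_cancel, hp.map_zero]
  refine ⟨{ toFun := p', map_add' := hadd, map_smul' := fun r x => ?_ }, hpm.1.2⟩
  obtain ⟨s, hs⟩ := exists_L0 (P := P) (r.measurable.max measurable_const : Measurable
    fun ω => max (r ω) 0)
  obtain ⟨t, ht⟩ := exists_L0 (P := P) (r.measurable.neg.max measurable_const : Measurable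
    fun ω => max (-r ω) 0)
  have hr : r = s - t := by
    rw [L0.eq_iff]
    filter_upwards [hs, ht, ae_sub s t] with ω h1 h2 h3
    rw [h3, h1, h2, Pi.neg_apply]
    rcases le_total (r ω) 0 with h | h
    · rw [max_eq_right h, max_eq_left (by linarith)]; ring
    · rw [max_eq_left h, max_eq_right (by linarith)]; ring
  have hs0 : 0 ≤ s := L0.nonneg_iff.2 (by
    filter_upwards [hs] with ω h; rw [h]; exact le_max_right _ _)
  have ht0 : 0 ≤ t := L0.nonneg_iff.2 (by
    filter_upwards [ht] with ω h; rw [h]; exact le_max_right _ _)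
  rw [RingHom.id_apply, hr, sub_smul, sub_eq_add_neg, hadd, hneg, hp.map_smul hs0, hp.map_smul ht0,
    smul_eq_mul, sub_mul, sub_eq_add_neg]

/-- Norming functionals exist. -/
theorem L0Norm.exists_norming (N : L0Norm P E) (x₀ : E) :
    ∃ f ∈ N.dualBall, f x₀ = N.toFun x₀ := by
  have hN : IsSublinear N.toFun := ⟨N.add_le, fun r x hr => by
    rw [N.map_smul, L0.le_iff]
    filter_upwards [ae_mul |r| (N.toFun x), ae_mul r (N.toFun x), ae_abs r, L0.nonneg_iff.1 hr]
      with ω h1 h2 h3 h4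
    rw [h1, h2, h3, abs_of_nonneg h4]⟩
  -- The lowered norm is at most `-‖x₀‖` at `-x₀`, so every linear function below it is at least
  -- `‖x₀‖` at `x₀`.
  obtain ⟨q, hq, hqN, hqx⟩ := hN.exists_shift x₀
  obtain ⟨f, hf⟩ := hq.exists_linearMap_le
  have h1 : ∀ x, f x ≤ N.toFun x := fun x => (hf x).trans (hqN x)
  refine ⟨f, N.mem_dualBall_iff.2 fun x => ?_, le_antisymm (h1 x₀) ?_⟩
  · have h2 := h1 (-x)
    rw [N.norm_neg, map_neg] at h2
    filter_upwards [L0.le_iff.1 (h1 x), L0.le_iff.1 h2, ae_neg (f x)] with ω h3 h4 h5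
    rw [abs_le]
    constructor <;> linarith
  · have h2 := (hf (-x₀)).trans (hqx (-x₀))
    rw [neg_add_cancel, N.norm_zero, zero_sub, map_neg] at h2
    exact neg_le_neg_iff.1 h2

/-- Uniform boundedness: weakly bounded stable sets are norm bounded. -/
theorem L0Norm.exists_bound_of_weakly_bounded (N : L0Norm P E) (hE : IsStableModule P E)
    {S : Set E} (hS : IsStableSet P S)
    (hb : ∀ f ∈ N.dual, ∃ C : L0 P, ∀ x ∈ S, ∀ᵐ ω ∂P, |f x ω| ≤ C ω) :
    ∃ C : L0 P, ∀ x ∈ S, ∀ᵐ ω ∂P, N.toFun x ω ≤ C ω := by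
  -- The function `1 / (1 + ‖x‖)` is bounded below even if `S` is unbounded. If its infimum `g` is
  -- positive a.e., then `1 / g` bounds the norms.
  have hφ : ∀ x, ∃ r : L0 P, ∀ᵐ ω ∂P, r ω = (1 + N.toFun x ω)⁻¹ := fun x =>
    exists_L0 (((N.toFun x).measurable.const_add 1).inv)
  choose φ hφ using hφ
  have hloc : LocalOn P S φ := by
    intro A hA x y _ _ h
    filter_upwards [N.norm_agree h, hφ x, hφ y] with ω h1 h2 h3 hω
    rw [h2, h3, h1 hω]
  obtain ⟨g, -, hg, hmin⟩ := exists_almost_min hS.1 (hS.glues hE) hloc (b := 0) (fun x _ => by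
    rw [L0.nonneg_iff]
    filter_upwards [hφ x, N.ae_nonneg x] with ω h1 h2
    rw [h1]; positivity)
  have hseq : ∀ n : ℕ, ∃ x ∈ S, ∀ᵐ ω ∂P, (1 + N.toFun x ω)⁻¹ ≤ g ω + ((9 : ℝ) ^ n)⁻¹ := by
    intro n
    obtain ⟨e, he, he'⟩ := exists_pos_const P (c := ((9 : ℝ) ^ n)⁻¹) (by positivity)
    obtain ⟨x, hx, hx'⟩ := hmin e he
    refine ⟨x, hx, ?_⟩
    filter_upwards [L0.le_iff.1 hx', he', hφ x, ae_add g e] with ω h1 h2 h3 h4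
    rwa [← h3, ← h2, ← h4]
  choose x hxS hx using hseq
  choose G hG hGx using fun n => N.exists_norming (x n)
  -- The sign makes the new term `± 3⁻ⁿ G n` agree in sign with the previous partial sum at `x n`,
  -- so that sum has absolute value at least `3⁻ⁿ ‖x n‖` there. The remaining terms contribute at
  -- most half of this.
  have hstep : ∀ (n : ℕ) (F : E →ₗ[L0 P] L0 P), ∃ s : L0 P, ∀ᵐ ω ∂P,
      s ω = if 0 ≤ F (x n) ω then ((3 : ℝ)⁻¹) ^ n else -((3 : ℝ)⁻¹) ^ n := fun n F =>
    exists_L0 (Measurable.ite (measurableSet_le measurable_const (F (x n)).measurable)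
      measurable_const measurable_const)
  choose s hs using hstep
  let F : ℕ → E →ₗ[L0 P] L0 P := fun n => Nat.rec 0 (fun n F => F + s n F • G n) n
  let y : ℕ → E →ₗ[L0 P] L0 P := fun n => s n (F n) • G n
  have hFs : ∀ n, F (n + 1) = F n + y n := fun n => rfl
  have hF : ∀ u, ∀ᵐ ω ∂P, ∀ n, F n u ω = ∑ i ∈ Finset.range n, y i u ω := by
    intro u
    rw [ae_all_iff]
    intro n
    induction n with
    | zero => filter_upwards [ae_zero (P := P)] with ω h; exact h
    | succ n ih =>
      filter_upwards [ih, ae_add (F n u) (y n u)] with ω h1 h2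
      rw [Finset.sum_range_succ, ← h1, ← h2, hFs, LinearMap.add_apply]
  have hyv : ∀ n u, ∀ᵐ ω ∂P, y n u ω = s n (F n) ω * G n u ω := fun n u =>
    ae_smul (s n (F n)) (G n u)
  have hy : ∀ n u, ∀ᵐ ω ∂P, |y n u ω| ≤ ((3 : ℝ)⁻¹) ^ n * N.toFun u ω := by
    intro n u
    filter_upwards [hyv n u, hs n (F n), N.mem_dualBall_iff.1 (hG n) u] with ω h1 h2 h3
    have h4 : |s n (F n) ω| = ((3 : ℝ)⁻¹) ^ n := by
      have : (0 : ℝ) ≤ ((3 : ℝ)⁻¹) ^ n := by positivity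
      rw [h2]
      split_ifs
      · exact abs_of_nonneg this
      · rw [abs_neg]; exact abs_of_nonneg this
    rw [h1, abs_mul, h4]
    gcongr
  have hgeo : HasSum (fun n : ℕ => ((3 : ℝ)⁻¹) ^ n) (3 / 2) := by
    have := hasSum_geometric_of_lt_one (r := (3 : ℝ)⁻¹) (by norm_num) (by norm_num)
    norm_num at this ⊢
    exact this
  obtain ⟨h, hh⟩ := N.exists_hasSum y hgeo.summable hy
  have hhd : h ∈ N.dual := by
    obtain ⟨e, -, he⟩ := exists_pos_const P (c := (3 / 2 : ℝ)) (by norm_num)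
    refine N.mem_dual_iff.2 ⟨e, fun u => ?_⟩
    filter_upwards [hh u, he, ae_all_iff.2 fun n => hy n u] with ω h1 h2 h3
    rw [h2]
    exact h1.norm_le_of_bounded (hgeo.mul_right _) h3
  obtain ⟨C, hC⟩ := hb h hhd
  have hkey : ∀ n, ∀ᵐ ω ∂P, N.toFun (x n) ω ≤ 2 * 3 ^ n * C ω := by
    intro n
    filter_upwards [hh (x n), ae_all_iff.2 fun k => hy k (x n), hC (x n) (hxS n), hF (x n),
      hyv n (x n), hs n (F n), N.ae_nonneg (x n)] with ω h1 h2 h3 h4 h5 h6 h7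
    have h8 := (hasSum_nat_add_iff' (n + 1)).2 h1
    have h9 : HasSum (fun k : ℕ => ((3 : ℝ)⁻¹) ^ (k + (n + 1)) * N.toFun (x n) ω)
        (3 / 2 * ((3 : ℝ)⁻¹) ^ (n + 1) * N.toFun (x n) ω) := by
      refine HasSum.mul_right _ ?_
      simp_rw [pow_add _ _ (n + 1)]
      exact hgeo.mul_right _
    have h10 := h8.norm_le_of_bounded h9 fun k => h2 _
    rw [Finset.sum_range_succ, ← h4 n, h5, hGx, h6, Real.norm_eq_abs] at h10
    have h11 : (3 : ℝ)⁻¹ ^ n * 3 ^ n = 1 := by rw [← mul_pow]; norm_num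
    have h12 : (0 : ℝ) < 3 ^ n := by positivity
    have h13 : (0 : ℝ) < (3 : ℝ)⁻¹ ^ n := by positivity
    have h14 : (3 : ℝ)⁻¹ ^ n * N.toFun (x n) ω ≤ 2 * C ω := by
      rw [pow_succ] at h10
      have h15 := abs_le.1 h10
      have h16 := abs_le.1 h3
      by_cases h17 : 0 ≤ F n (x n) ω
      · rw [if_pos h17] at h15
        linarith [h15.1]
      · rw [if_neg h17] at h15
        linarith [h15.2]
    calc N.toFun (x n) ω = 3 ^ n * ((3 : ℝ)⁻¹ ^ n * N.toFun (x n) ω) := by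
          rw [← mul_assoc, mul_comm (3 ^ n : ℝ), h11, one_mul]
      _ ≤ 3 ^ n * (2 * C ω) := by gcongr
      _ = _ := by ring
  have hgpos : ∀ᵐ ω ∂P, 0 < g ω := by
    filter_upwards [ae_all_iff.2 hkey, ae_all_iff.2 hx, ae_all_iff.2 fun n => N.ae_nonneg (x n)]
      with ω h1 h2 h3
    by_contra h4
    rw [not_lt] at h4
    -- Where `g ≤ 0`, the choice of `x n` makes the norm at least `9ⁿ - 1`, too large for the bound
    -- `2 · 3ⁿ C`.
    obtain ⟨n, hn⟩ := pow_unbounded_of_one_lt (2 * C ω + 1) (by norm_num : (1 : ℝ) < 3)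
    have h5 : (1 + N.toFun (x n) ω)⁻¹ ≤ ((9 : ℝ) ^ n)⁻¹ := by linarith [h2 n]
    have h6 : (9 : ℝ) ^ n ≤ 1 + N.toFun (x n) ω :=
      (inv_le_inv₀ (by linarith [h3 n]) (by positivity)).1 h5
    have h7 : (9 : ℝ) ^ n = 3 ^ n * 3 ^ n := by rw [← mul_pow]; norm_num
    have h8 : (1 : ℝ) ≤ 3 ^ n := one_le_pow₀ (by norm_num)
    have h9 := h1 n
    nlinarith
  obtain ⟨C', hC'⟩ := exists_L0 (P := P) g.measurable.inv
  refine ⟨C', fun u hu => ?_⟩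
  filter_upwards [hC', hgpos, L0.le_iff.1 (hg u hu), hφ u, N.ae_nonneg u] with ω h1 h2 h3 h4 h5
  rw [h4] at h3
  rw [h1, Pi.inv_apply]
  have := (le_inv_comm₀ h2 (by linarith)).1 h3
  linarith

end HahnBanach

/-! ### Maximal stable filter bases and their limits. -/

section MaximalFilters

variable {P : Measure Ω} {E : Type*} [AddCommGroup E] [Module (L0 P) E]

/-- Sets closed under concatenations. -/
def ConcatClosed (P : Measure Ω) {M : Type*} [AddCommGroup M] [Module (L0 P) M] (Y : Set M) :
    Prop :=
  ∀ (a : Partition Ω) (x : ℕ → M) (y : M), (∀ k, x k ∈ Y) → IsConcat P a x y → y ∈ Y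

/-- Maximal stable filter bases: maximal families of stable sets closed under intersections. -/
structure IsMaximalBase (P : Measure Ω) {M : Type*} [AddCommGroup M] [Module (L0 P) M]
    (B : Set (Set M)) : Prop where
  stable : ∀ V ∈ B, IsStableSet P V
  inter : ∀ U ∈ B, ∀ V ∈ B, U ∩ V ∈ B
  maximal : ∀ Y, ConcatClosed P Y → (∀ V ∈ B, (Y ∩ V).Nonempty) → Y ∈ B

theorem ConcatClosed.inter {Y V : Set E} (hY : ConcatClosed P Y) (hV : ConcatClosed P V) :
    ConcatClosed P (Y ∩ V) := fun a x y hx hy =>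
  ⟨hY a x y (fun k => (hx k).1) hy, hV a x y (fun k => (hx k).2) hy⟩

/-- Zorn's lemma above the stable members of `F`. These bases take the place of ultrafilters: a
concatenation-closed set meeting every member is itself a member. -/
theorem exists_isMaximalBase {S : Set E} (hS : IsStableSet P S) {F : Filter E}
    (hF : IsStableFilterOn P S F) :
    ∃ B : Set (Set E), IsMaximalBase P B ∧ S ∈ B ∧ ∀ U ∈ F, ∃ V ∈ B, V ⊆ U := by
  obtain ⟨B₀, hB₀, hB₀S, hB₀F⟩ := hF
  have hne : F.NeBot := by
    refine Filter.neBot_iff.2 fun h => ?_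
    obtain ⟨U, hU, hU'⟩ := (hB₀F ∅).1 (by rw [h]; trivial)
    exact (hB₀.2.1 U hU).1.ne_empty (Set.subset_eq_empty hU' rfl)
  let D : Set (Set E) := {V | IsStableSet P V ∧ V ∈ F}
  obtain ⟨U₀, hU₀⟩ := hB₀.1
  have hU₀F : ∀ U ∈ B₀, U ∈ F := fun U hU => (hB₀F U).2 ⟨U, hU, subset_rfl⟩
  obtain ⟨B, hDB, hB⟩ := zorn_subset_nonempty
    {B : Set (Set E) | D ⊆ B ∧ (∀ V ∈ B, IsStableSet P V) ∧ ∀ U ∈ B, ∀ V ∈ B, U ∩ V ∈ B} (by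
    intro c hc hchain hcne
    obtain ⟨b₀, hb₀⟩ := hcne
    refine ⟨⋃₀ c, ⟨(hc hb₀).1.trans (Set.subset_sUnion_of_mem hb₀), ?_, ?_⟩,
      fun s hs => Set.subset_sUnion_of_mem hs⟩
    · rintro V ⟨b, hb, hV⟩
      exact (hc hb).2.1 V hV
    · rintro U ⟨b, hb, hU⟩ V ⟨b', hb', hV⟩
      rcases hchain.total hb hb' with h | h
      · exact ⟨b', hb', (hc hb').2.2 U (h hU) V hV⟩
      · exact ⟨b, hb, (hc hb).2.2 U hU V (h hV)⟩) D ⟨subset_rfl, fun V hV => hV.1, by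
    rintro U ⟨hU, hUF⟩ V ⟨hV, hVF⟩
    have hUV := Filter.inter_mem hUF hVF
    exact ⟨⟨hne.nonempty_of_mem hUV, ConcatClosed.inter hU.2 hV.2⟩, hUV⟩⟩
  refine ⟨B, ⟨hB.1.2.1, hB.1.2.2, fun Y hY hYV => ?_⟩, hDB ⟨hS, Filter.mem_of_superset
    (hU₀F U₀ hU₀) (hB₀S U₀ hU₀)⟩, fun U hU => ?_⟩
  · have hU₀B : U₀ ∈ B := hDB ⟨hB₀.2.1 U₀ hU₀, hU₀F U₀ hU₀⟩
    -- The base generated by `B` and `Y` is again admissible, hence equals `B` by maximality.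
    let B' : Set (Set E) := {W | IsStableSet P W ∧ ∃ V ∈ B, Y ∩ V ⊆ W}
    have hBB' : B ⊆ B' := fun V hV => ⟨hB.1.2.1 V hV, V, hV, Set.inter_subset_right⟩
    have hB' : B' ⊆ B := by
      refine hB.2 ⟨hDB.trans hBB', fun V hV => hV.1, ?_⟩ hBB'
      rintro W ⟨hW, V, hV, h⟩ W' ⟨hW', V', hV', h'⟩
      have hsub : Y ∩ (V ∩ V') ⊆ W ∩ W' := fun x hx =>
        ⟨h ⟨hx.1, hx.2.1⟩, h' ⟨hx.1, hx.2.2⟩⟩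
      exact ⟨⟨(hYV _ (hB.1.2.2 V hV V' hV')).mono hsub, ConcatClosed.inter hW.2 hW'.2⟩,
        _, hB.1.2.2 V hV V' hV', hsub⟩
    exact hB' ⟨⟨(hYV U₀ hU₀B).mono Set.inter_subset_left, hY⟩, U₀, hU₀B, Set.inter_subset_left⟩
  · obtain ⟨V, hV, hVU⟩ := (hB₀F U).1 hU
    exact ⟨V, hDB ⟨hB₀.2.1 V hV, hU₀F V hV⟩, hVU⟩

/-- Bounded linear functions converge along maximal stable filter bases. -/
theorem IsMaximalBase.exists_limit [IsProbabilityMeasure P] (hE : IsStableModule P E)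
    {B : Set (Set E)} (hB : IsMaximalBase P B) {S : Set E} (hSB : S ∈ B) (f : E →ₗ[L0 P] L0 P)
    {C : L0 P} (hC : ∀ x ∈ S, ∀ᵐ ω ∂P, |f x ω| ≤ C ω) :
    ∃ z : L0 P, ∀ ε : L0 P, SLT P 0 ε → {x | ∀ᵐ ω ∂P, |f x ω - z ω| ≤ ε ω} ∈ B := by
  have hloc : ∀ X : Set E, LocalOn P X f := fun X A hA x y _ _ h => agreeOn_L0.1 (h.map f)
  have hsup : ∀ V : B, ∃ g : L0 P, (∀ x ∈ V.1 ∩ S, f x ≤ g) ∧ ∀ ε : L0 P, SLT P 0 ε →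
      ∃ x ∈ V.1 ∩ S, g ≤ f x + ε := by
    intro V
    have h1 := hB.stable _ (hB.inter _ V.2 _ hSB)
    refine exists_almost_max h1.1 (h1.glues hE) (hloc _) (b := C) fun x hx => L0.le_iff.2 ?_
    filter_upwards [hC x hx.2] with ω h
    exact (abs_le.1 h).2
  choose s hs hs' using hsup
  -- The limit is the upper limit: the infimum over the base of the suprema of `f`.
  obtain ⟨z, hz, t, htT, ht⟩ := exists_isGLB_L0 (T := Set.range s) ⟨_, ⟨S, hSB⟩, rfl⟩ (b := -C) (by
    rintro _ ⟨V, rfl⟩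
    obtain ⟨x, hx⟩ := (hB.stable _ (hB.inter _ V.2 _ hSB)).1
    refine le_trans ?_ (hs V x hx)
    rw [L0.le_iff]
    filter_upwards [hC x hx.2, ae_neg C] with ω h h'
    rw [h']
    exact (abs_le.1 h).1)
  choose V hV using htT
  refine ⟨z, fun ε hε => hB.maximal _ ?_ ?_⟩
  · intro a x y hx hy
    refine a.ae_of_forall fun k => ?_
    have h1 : AgreeOn (P := P) (a.measurableSet k) y (x k) := hy k
    filter_upwards [hx k, agreeOn_L0.1 (h1.map f)] with ω h1 h2 hω
    rw [h2 hω]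
    exact h1
  · intro U hU
    have h1 : ∀ n, (V n).1 ∩ U ∈ B := fun n => hB.inter _ (V n).2 _ hU
    -- A near maximiser over `V n ∩ U ∩ S` has value at least `z - ε`, and at most the supremum over
    -- `V n ∩ S`, which is at most `z + ε` on part `n`.
    choose x hx hx' using fun n => hs' ⟨_, h1 n⟩ ε hε
    obtain ⟨a, ha⟩ := exists_partition (P := P) (fun n => measurableSet_le_L0 (t n) (z + ε)) (by
      filter_upwards [ht, SLT_zero_iff.1 hε, ae_add z ε] with ω h1 h2 h3
      obtain ⟨n, hn⟩ := h1 _ h2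
      exact ⟨n, by rw [h3]; exact hn.le⟩)
    obtain ⟨y, hy, hya⟩ := (hB.stable U hU).glues hE a x fun k => (hx k).1.2
    refine ⟨y, a.ae_of_forall fun k => ?_, hy⟩
    have h2 : AgreeOn (P := P) (a.measurableSet k) y (x k) := hya k
    filter_upwards [ha k, agreeOn_L0.1 (h2.map f), L0.le_iff.1 (hx' k),
      L0.le_iff.1 (hz.1 ⟨⟨_, h1 k⟩, rfl⟩), L0.le_iff.1 (hs (V k) (x k) ⟨(hx k).1.1, (hx k).2⟩),
      ae_add z ε, ae_add (f (x k)) ε] with ω h3 h4 h5 h6 h7 h8 h9 hω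
    have h10 := h3 hω
    rw [h8, ← hV k] at h10
    rw [h4 hω, abs_le]
    constructor <;> linarith

theorem IsMaximalBase.finset_inter {B : Set (Set E)} (hB : IsMaximalBase P B) {S : Set E}
    (hSB : S ∈ B) {ι : Type*} (s : Finset ι) (Y : ι → Set E) (hY : ∀ i ∈ s, Y i ∈ B) :
    {x | x ∈ S ∧ ∀ i ∈ s, x ∈ Y i} ∈ B := by
  classical
  induction s using Finset.induction_on with
  | empty => simpa using hSB
  | insert i s his ih =>
    have h1 := hB.inter _ (hY i (Finset.mem_insert_self i s)) _
      (ih fun j hj => hY j (Finset.mem_insert_of_mem hj))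
    convert h1 using 1
    ext x
    simp only [Finset.mem_insert, forall_eq_or_imp, Set.mem_ofPred_eq, Set.mem_inter_iff]
    tauto

/-- If the limits along a maximal base are the values at `x`, then the base converges weakly
to `x`. -/
theorem IsMaximalBase.exists_subset_of_isOpen [IsProbabilityMeasure P] (N : L0Norm P E)
    (hE : IsStableModule P E) {B : Set (Set E)} (hB : IsMaximalBase P B) {S : Set E} (hSB : S ∈ B)
    {x : E} (hx : ∀ f ∈ N.dual, ∀ ε : L0 P, SLT P 0 ε →
      {y | ∀ᵐ ω ∂P, |f y ω - f x ω| ≤ ε ω} ∈ B)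
    {U : Set E} (hU : @IsOpen E N.weakTopology U) : x ∈ U → ∃ V ∈ B, V ⊆ U := by
  induction hU with
  | univ => exact fun _ => ⟨S, hSB, Set.subset_univ _⟩
  | inter U V _ _ hU hV =>
    intro h
    obtain ⟨U', hU', h1⟩ := hU h.1
    obtain ⟨V', hV', h2⟩ := hV h.2
    exact ⟨U' ∩ V', hB.inter _ hU' _ hV', Set.inter_subset_inter h1 h2⟩
  | sUnion C _ hC =>
    rintro ⟨U, hU, h⟩
    obtain ⟨V, hV, h1⟩ := hC U hU h
    exact ⟨V, hV, h1.trans (Set.subset_sUnion_of_mem hU)⟩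
  | basic U hU =>
    obtain ⟨N', c, r, hN', ⟨hNs, n, g, hg, hgN⟩, hr, rfl⟩ := hU
    rintro ⟨s, hs, hsr⟩
    -- Half of the slack: moving every seminorm by at most `ε` keeps the supremum below `s + ε < r`.
    obtain ⟨ε, hε⟩ := exists_L0 (P := P) (φ := fun ω => (r ω - s ω) / 2)
      ((r.measurable.sub s.measurable).div_const 2)
    have hε0 : SLT P 0 ε := by
      rw [SLT_zero_iff]
      filter_upwards [hε, hsr] with ω h1 h2
      rw [h1]; linarith
    let Y : Set E := {y | ∀ f ∈ N.dual, (fun v => |f v|) ∈ N' → ∀ᵐ ω ∂P, |f y ω - f x ω| ≤ ε ω}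
    refine ⟨Y, hB.maximal _ ?_ ?_, ?_⟩
    · intro a u y hu hy f hf hfN
      refine a.ae_of_forall fun k => ?_
      have h1 : AgreeOn (P := P) (a.measurableSet k) y (u k) := hy k
      filter_upwards [hu k f hf hfN, agreeOn_L0.1 (h1.map f)] with ω h1 h2 hω
      rw [h2 hω]
      exact h1
    · intro V hV
      have hn : (1 : L0N P) ≤ n := by
        obtain ⟨p, hp⟩ := hNs.1
        obtain ⟨l, hl, -⟩ := hgN.surjOn hp
        exact hl.1.trans hl.2
      have hn' : ∀ᵐ ω ∂P, 1 ≤ n ω := by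
        filter_upwards [AEEqFun.coeFn_le.2 hn, AEEqFun.coeFn_one (μ := P) (β := ℕ) (α := Ω)]
          with ω h1 h2
        rw [h2] at h1; exact h1
      -- The constant index `m` is clamped to `[1, n]`. On `{n = k}` the seminorms at `l 0, …, l k`
      -- determine the whole stable finite family, leaving finitely many conditions there.
      have hm : ∀ m : ℕ, ∃ l : L0N P, ∀ᵐ ω ∂P, l ω = max (min m (n ω)) 1 := fun m =>
        exists_L0N ((measurable_const.min n.measurable).max measurable_const)
      choose l hl using hm
      have hl' : ∀ m, l m ∈ Set.Icc 1 n := by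
        intro m
        constructor
        · rw [← AEEqFun.coeFn_le]
          filter_upwards [hl m, AEEqFun.coeFn_one (μ := P) (β := ℕ) (α := Ω)] with ω h1 h2
          rw [h1, h2]; exact le_max_right _ _
        · rw [← AEEqFun.coeFn_le]
          filter_upwards [hl m, hn'] with ω h1 h2
          rw [h1]; exact max_le (min_le_right _ _) h2
      have hf : ∀ m, ∃ f ∈ N.dual, g (l m) = fun v => |f v| := fun m => hN' (hgN.mapsTo (hl' m))
      choose f hfd hfg using hf
      have hW : ∀ k : ℕ, ∃ y ∈ V, ∀ m ≤ k, ∀ᵐ ω ∂P, |f m y ω - f m x ω| ≤ ε ω := by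
        intro k
        have h1 := hB.finset_inter hV (Finset.range (k + 1))
          (fun m => {y | ∀ᵐ ω ∂P, |f m y ω - f m x ω| ≤ ε ω}) fun m _ => hx (f m) (hfd m) ε hε0
        obtain ⟨y, hy, hy'⟩ := (hB.stable _ h1).1
        exact ⟨y, hy, fun m hmk => hy' m (Finset.mem_range.2 (Nat.lt_succ_of_le hmk))⟩
      choose y hyV hy using hW
      obtain ⟨v, hvV, hv⟩ := (hB.stable V hV).glues hE (levels n) y hyV
      refine ⟨v, fun h hh hhN => ?_, hvV⟩
      obtain ⟨q, hq, hqh⟩ := hgN.surjOn hhN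
      have hq1 : ∀ᵐ ω ∂P, 1 ≤ q ω := by
        filter_upwards [AEEqFun.coeFn_le.2 hq.1, AEEqFun.coeFn_one (μ := P) (β := ℕ) (α := Ω)]
          with ω h1 h2
        rw [h2] at h1; exact h1
      have hq2 : ∀ᵐ ω ∂P, q ω ≤ n ω := AEEqFun.coeFn_le.2 hq.2
      -- Any index `q` of the family is glued from the clamped constants, so on `{q = m}` its
      -- seminorm is the one of `f m`.
      have hcon := hg (levels q) l q hl' hq (fun m => by
        filter_upwards [hl m, hq1, hq2] with ω h1 h2 h3 hω
        have h4 : q ω = m := hω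
        rw [h4] at h2 h3
        rw [h1, h4, min_eq_left h3, max_eq_left h2])
      have hgq : ∀ m w, ∀ᵐ ω ∂P, q ω = m → |h w ω| = |f m w ω| := by
        intro m w
        have h1 := agreeOn_L0.1 (agreeOn_pi.1 (show AgreeOn (P := P) ((levels q).measurableSet m)
          (g q) (g (l m)) from hcon m) w)
        rw [hqh, hfg] at h1
        filter_upwards [h1, ae_abs (h w), ae_abs (f m w)] with ω h1 h2 h3 hω
        rw [← h2, ← h3]
        exact h1 hω
      refine (levels n).ae_of_forall fun k => (levels q).ae_of_forall fun m => ?_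
      have h1 : AgreeOn (P := P) ((levels n).measurableSet k) v (y k) := hv k
      by_cases hmk : m ≤ k
      · have h5 : ∀ᵐ ω ∂P, h (y k - x) ω = h (y k) ω - h x ω := by rw [map_sub]; exact ae_sub _ _
        have h6 : ∀ᵐ ω ∂P, f m (y k - x) ω = f m (y k) ω - f m x ω := by
          rw [map_sub]; exact ae_sub _ _
        filter_upwards [agreeOn_L0.1 (h1.map h), hgq m (y k - x), hy k m hmk, h5, h6]
          with ω h1 h2 h3 h5 h6 hωm hωk
        rw [h1 hωk, ← h5, h2 hωm, h6]
        exact h3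
      · filter_upwards [hq2] with ω h2 hωm hωk
        have h3 : q ω = m := hωm
        have h4 : n ω = k := hωk
        omega
    · intro y hy
      have hb : ∀ t ∈ (fun p : E → L0 P => p (c - y)) '' N', t ≤ s + ε := by
        rintro _ ⟨p, hp, rfl⟩
        obtain ⟨f, hf, rfl⟩ := hN' hp
        have h1 := hs.1 ⟨_, hp, rfl⟩
        have h5 : ∀ᵐ ω ∂P, f (c - y) ω = f c ω - f y ω := by rw [map_sub]; exact ae_sub _ _
        have h6 : ∀ᵐ ω ∂P, f (c - x) ω = f c ω - f x ω := by rw [map_sub]; exact ae_sub _ _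
        rw [L0.le_iff]
        filter_upwards [L0.abs_le_iff.1 h1, hy f hf hp, h5, h6, ae_abs (f (c - y)), ae_add s ε]
          with ω h1 h2 h3 h4 h5 h6
        rw [h5, h6, h3]
        rw [h4] at h1
        have h7 := abs_sub_le (f c ω) (f x ω) (f y ω)
        rw [abs_sub_comm (f x ω)] at h7
        linarith
      obtain ⟨t, ht⟩ := exists_isLUB_L0 (hNs.1.image _) hb
      refine ⟨t, ht, ?_⟩
      unfold SLT
      filter_upwards [L0.le_iff.1 (ht.2 hb), ae_add s ε, hε, hsr] with ω h1 h2 h3 h4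
      linarith

end MaximalFilters

/-! ### Weak-* limits in the bidual and Helly's theorem. -/

section Limits

variable {P : Measure Ω} {E : Type*} [AddCommGroup E] [Module (L0 P) E]

/-- `z`, considered as a function on the dual, is in the weak-* closure of `S` in the bidual. -/
def IsLimitOf (N : L0Norm P E) (S : Set E) (z : (E →ₗ[L0 P] L0 P) → L0 P) : Prop :=
  ∀ s : Finset (E →ₗ[L0 P] L0 P), (∀ f ∈ s, f ∈ N.dual) → ∀ ε : L0 P, SLT P 0 ε →
    ∃ x ∈ S, ∀ f ∈ s, ∀ᵐ ω ∂P, |f x ω - z f ω| ≤ ε ω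

variable {N : L0Norm P E} {S : Set E} {z : (E →ₗ[L0 P] L0 P) → L0 P}

/-- A single point of `S` approximates `z` at `f`, `g` and `f + g` simultaneously, and evaluation at
that point is additive. -/
theorem IsLimitOf.map_add (hz : IsLimitOf N S z) {f g : E →ₗ[L0 P] L0 P} (hf : f ∈ N.dual)
    (hg : g ∈ N.dual) : z (f + g) = z f + z g := by
  classical
  have h1 : ∀ n : ℕ, ∀ᵐ ω ∂P, |z (f + g) ω - (z f ω + z g ω)| ≤ 0 + 3 * (1 / ((n : ℝ) + 1)) := by
    intro n
    obtain ⟨e, he, he'⟩ := exists_pos_const P (c := 1 / ((n : ℝ) + 1)) (by positivity)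
    obtain ⟨x, -, hx⟩ := hz {f, g, f + g} (by
      simp only [Finset.mem_insert, Finset.mem_singleton]
      rintro _ (rfl | rfl | rfl)
      exacts [hf, hg, N.dual_add hf hg]) e he
    filter_upwards [hx f (by simp), hx g (by simp), hx (f + g) (by simp), he', ae_add (f x) (g x)]
      with ω h1 h2 h3 h4 h5
    rw [LinearMap.add_apply, h5, h4, abs_le] at h3
    rw [h4, abs_le] at h1 h2
    rw [abs_le]
    constructor <;> linarith
  rw [L0.eq_iff]
  filter_upwards [ae_all_iff.2 h1, ae_add (z f) (z g)] with ω h2 h3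
  rw [h3, ← sub_eq_zero, ← abs_eq_zero]
  refine le_antisymm ?_ (abs_nonneg _)
  have h4 : Filter.Tendsto (fun n : ℕ => 0 + 3 * (1 / ((n : ℝ) + 1))) Filter.atTop
      (nhds (0 + 3 * 0)) := (tendsto_one_div_add_atTop_nhds_zero_nat.const_mul _).const_add _
  have h5 := ge_of_tendsto' h4 h2
  simpa using h5

theorem IsLimitOf.map_smul (hz : IsLimitOf N S z) {f : E →ₗ[L0 P] L0 P} (hf : f ∈ N.dual)
    (r : L0 P) : z (r • f) = r * z f := by
  classical
  have h1 : ∀ n : ℕ, ∀ᵐ ω ∂P, |z (r • f) ω - r ω * z f ω| ≤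
      0 + (1 + |r ω|) * (1 / ((n : ℝ) + 1)) := by
    intro n
    obtain ⟨e, he, he'⟩ := exists_pos_const P (c := 1 / ((n : ℝ) + 1)) (by positivity)
    obtain ⟨x, -, hx⟩ := hz {f, r • f} (by
      simp only [Finset.mem_insert, Finset.mem_singleton]
      rintro _ (rfl | rfl)
      exacts [hf, N.dual_smul r hf]) e he
    filter_upwards [hx f (by simp), hx (r • f) (by simp), he', ae_smul r (f x)]
      with ω h1 h2 h4 h5
    rw [LinearMap.smul_apply, h5, h4] at h2
    rw [h4] at h1
    have h6 := abs_sub_le (z (r • f) ω) (r ω * f x ω) (r ω * z f ω)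
    rw [abs_sub_comm (z (r • f) ω) (r ω * f x ω), ← mul_sub, abs_mul] at h6
    have h7 := mul_le_mul_of_nonneg_left h1 (abs_nonneg (r ω))
    linarith
  rw [L0.eq_iff]
  filter_upwards [ae_all_iff.2 h1, ae_mul r (z f)] with ω h2 h3
  rw [h3, ← sub_eq_zero, ← abs_eq_zero]
  refine le_antisymm ?_ (abs_nonneg _)
  have h4 : Filter.Tendsto (fun n : ℕ => 0 + (1 + |r ω|) * (1 / ((n : ℝ) + 1))) Filter.atTop
      (nhds (0 + (1 + |r ω|) * 0)) :=
    (tendsto_one_div_add_atTop_nhds_zero_nat.const_mul _).const_add _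
  have h5 := ge_of_tendsto' h4 h2
  simpa using h5

theorem IsLimitOf.agree (hz : IsLimitOf N S z) {f g : E →ₗ[L0 P] L0 P} (hf : f ∈ N.dual)
    (hg : g ∈ N.dual) {A : Set Ω} {hA : MeasurableSet A} (h : AgreeOn (P := P) hA f g) :
    AgreeOn (P := P) hA (z f) (z g) := by
  unfold AgreeOn at *
  rw [smul_eq_mul, smul_eq_mul, ← hz.map_smul hf, ← hz.map_smul hg, h]

theorem IsLimitOf.abs_le (hz : IsLimitOf N S z) {C : L0 P}
    (hC : ∀ x ∈ S, ∀ᵐ ω ∂P, N.toFun x ω ≤ C ω) [IsProbabilityMeasure P] {f : E →ₗ[L0 P] L0 P}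
    (hf : f ∈ N.dualBall) : ∀ᵐ ω ∂P, |z f ω| ≤ C ω := by
  have h1 : ∀ n : ℕ, ∀ᵐ ω ∂P, |z f ω| ≤ C ω + 1 / ((n : ℝ) + 1) := by
    intro n
    obtain ⟨e, he, he'⟩ := exists_pos_const P (c := 1 / ((n : ℝ) + 1)) (by positivity)
    obtain ⟨x, hxS, hx⟩ := hz {f} (by simpa using hf.1) e he
    filter_upwards [hx f (by simp), he', hC x hxS, N.mem_dualBall_iff.1 hf x] with ω h1 h2 h3 h4
    rw [h2] at h1
    have h5 := abs_sub_abs_le_abs_sub (z f ω) (f x ω)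
    rw [abs_sub_comm] at h5
    linarith
  filter_upwards [ae_all_iff.2 h1] with ω h2
  have h4 : Filter.Tendsto (fun n : ℕ => C ω + 1 / ((n : ℝ) + 1)) Filter.atTop
      (nhds (C ω + 0)) := tendsto_one_div_add_atTop_nhds_zero_nat.const_add _
  rw [add_zero] at h4
  exact ge_of_tendsto' h4 h2

theorem L0Norm.ball_convex [IsProbabilityMeasure P] (N : L0Norm P E) {f g : E →ₗ[L0 P] L0 P}
    (hf : f ∈ N.dualBall) (hg : g ∈ N.dualBall) {t : L0 P} (ht : ∀ᵐ ω ∂P, 0 ≤ t ω ∧ t ω ≤ 1) :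
    f + t • (g - f) ∈ N.dualBall := by
  rw [mem_dualBall_iff] at *
  intro x
  filter_upwards [hf x, hg x, ht, ae_add (f x) (t • (g x - f x)), ae_smul t (g x - f x),
    ae_sub (g x) (f x)] with ω h1 h2 h3 h4 h5 h6
  rw [LinearMap.add_apply, LinearMap.smul_apply, LinearMap.sub_apply, h4, h5, h6]
  rw [_root_.abs_le] at *
  constructor <;> nlinarith

theorem L0Norm.ball_neg [IsProbabilityMeasure P] (N : L0Norm P E) {f : E →ₗ[L0 P] L0 P}
    (hf : f ∈ N.dualBall) : -f ∈ N.dualBall := by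
  rw [mem_dualBall_iff] at *
  intro x
  filter_upwards [hf x, ae_neg (f x)] with ω h1 h2
  rw [LinearMap.neg_apply, h2, abs_neg]
  exact h1

theorem L0Norm.zero_mem_ball [IsProbabilityMeasure P] (N : L0Norm P E) : 0 ∈ N.dualBall := by
  rw [mem_dualBall_iff]
  intro x
  filter_upwards [ae_zero (P := P), N.ae_nonneg x] with ω h1 h2
  rw [LinearMap.zero_apply, h1]
  simpa using h2

/-- A form of Helly's theorem: if `z` has distance at least `d` from `E`, then it is almost normed
by functionals that are small at finitely many given points. -/
theorem IsLimitOf.helly [IsProbabilityMeasure P] (hz : IsLimitOf N S z) {C : L0 P}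
    (hC : ∀ x ∈ S, ∀ᵐ ω ∂P, N.toFun x ω ≤ C ω) {d : L0 P} (hd : 0 ≤ d)
    (hdist : ∀ (x : E) (b : L0 P), (∀ f ∈ N.dualBall, ∀ᵐ ω ∂P, z f ω - f x ω ≤ b ω) → d ≤ b)
    {ι : Type*} (s : Finset ι) (x : ι → E) {ε : ℝ} (hε : 0 < ε) :
    ∃ f ∈ N.dualBall, (∀ i ∈ s, ∀ᵐ ω ∂P, |f (x i) ω| ≤ ε) ∧ ∀ᵐ ω ∂P, d ω - ε ≤ z f ω := by
  have hQex : ∀ f : E →ₗ[L0 P] L0 P, ∃ q : L0 P, ∀ᵐ ω ∂P, q ω = ∑ i ∈ s, (f (x i) ω) ^ 2 := fun f =>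
    exists_L0 (Finset.measurable_fun_sum _ fun i _ => (f (x i)).measurable.pow_const 2)
  choose Q hQ using hQex
  obtain ⟨K, hK⟩ := exists_L0 (P := P) (φ := fun ω => ∑ i ∈ s, (N.toFun (x i) ω) ^ 2)
    (Finset.measurable_fun_sum _ fun i _ => (N.toFun (x i)).measurable.pow_const 2)
  -- The penalty weight: the estimate `c Q f ≤ |C| + ε` below becomes `Q f ≤ ε²`.
  obtain ⟨c, hc⟩ := exists_L0 (P := P) (φ := fun ω => (|C ω| + ε) / ε ^ 2)
    ((C.measurable.abs.add_const _).div_const _)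
  -- The step length makes the second-order penalty term, after division by `t`, at most `ε / 2`.
  -- The slack `η = t ε / 2` contributes the other half.
  obtain ⟨t, ht⟩ := exists_L0 (P := P) (φ := fun ω => ε / (ε + 4 * (c ω * K ω)))
    (measurable_const.div (((c.measurable.mul K.measurable).const_mul 4).const_add _))
  obtain ⟨η, hη⟩ := exists_L0 (P := P) (φ := fun ω => t ω * ε / 2)
    ((t.measurable.mul_const _).div_const _)
  have hK0 : ∀ᵐ ω ∂P, 0 ≤ K ω := by
    filter_upwards [hK] with ω h
    rw [h]; exact Finset.sum_nonneg fun i _ => sq_nonneg _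
  have hc0 : ∀ᵐ ω ∂P, 0 < c ω := by
    filter_upwards [hc] with ω h
    rw [h]; positivity
  have ht0 : ∀ᵐ ω ∂P, 0 < t ω ∧ t ω ≤ 1 ∧ 2 * (c ω * t ω * K ω) ≤ ε / 2 := by
    filter_upwards [ht, hK0, hc0] with ω h1 h2 h3
    have h4 : 0 < ε + 4 * (c ω * K ω) := by positivity
    have h5 : 0 ≤ c ω * K ω := by positivity
    rw [h1]
    refine ⟨by positivity, (div_le_one h4).2 (by linarith), ?_⟩
    have h6 : 2 * (c ω * (ε / (ε + 4 * (c ω * K ω))) * K ω) =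
        (2 * ε * (c ω * K ω)) / (ε + 4 * (c ω * K ω)) := by ring
    rw [h6, div_le_div_iff₀ h4 two_pos]
    nlinarith
  have hη0 : SLT P 0 η := by
    rw [SLT_zero_iff]
    filter_upwards [hη, ht0] with ω h1 h2
    rw [h1]
    have := h2.1
    positivity
  -- Almost maximising `z f` minus a quadratic penalty over the dual ball replaces a separation
  -- argument.
  have hJex : ∀ f : E →ₗ[L0 P] L0 P, ∃ q : L0 P, ∀ᵐ ω ∂P, q ω = z f ω - c ω / 2 * Q f ω := fun f =>
    exists_L0 ((z f).measurable.sub ((c.measurable.div_const 2).mul (Q f).measurable))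
  choose J hJ using hJex
  have hloc : LocalOn P N.dualBall J := by
    intro A hA f g hf hg h
    have h1 := agreeOn_L0.1 (hz.agree hf.1 hg.1 h)
    have h2 : ∀ᵐ ω ∂P, ω ∈ A → ∀ i ∈ s, f (x i) ω = g (x i) ω := by
      have h3 := (Filter.eventually_all_finset s).2 fun i _ =>
        agreeOn_L0.1 (agreeOn_linearMap.1 h (x i))
      filter_upwards [h3] with ω h3 hω i hi
      exact h3 i hi hω
    filter_upwards [h1, h2, hQ f, hQ g, hJ f, hJ g] with ω h1 h2 h3 h4 h5 h6 hω
    rw [h5, h6, h3, h4, h1 hω, Finset.sum_congr rfl fun i hi => by rw [h2 hω i hi]]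
  have hQ0 : ∀ f, ∀ᵐ ω ∂P, 0 ≤ Q f ω := fun f => by
    filter_upwards [hQ f] with ω h
    rw [h]; exact Finset.sum_nonneg fun i _ => sq_nonneg _
  obtain ⟨m, hm, hm'⟩ := exists_almost_max ⟨0, N.zero_mem_ball⟩ N.glues_dualBall hloc (b := C)
    (fun f hf => by
      rw [L0.le_iff]
      filter_upwards [hz.abs_le hC hf, hJ f, hQ0 f, hc0] with ω h1 h2 h3 h4
      rw [h2]
      have h5 := (_root_.abs_le.1 h1).2
      have h6 : 0 ≤ c ω / 2 * Q f ω := by positivity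
      linarith)
  obtain ⟨f, hf, hfm⟩ := hm' η hη0
  -- The derivative of the penalty at `f` is evaluation at this point. Moving from `f` towards `g`
  -- gives `z g - g a ≤ z f - c Q f + ε` for every `g` in the ball, which the distance hypothesis at
  -- `a` converts into a lower bound for `z f`.
  let a : E := ∑ i ∈ s, (c * f (x i)) • x i
  have ha : ∀ g : E →ₗ[L0 P] L0 P, ∀ᵐ ω ∂P, g a ω = c ω * ∑ i ∈ s, f (x i) ω * g (x i) ω := by
    intro g
    have h1 : g a = ∑ i ∈ s, (c * f (x i)) * g (x i) := by
      simp only [a, map_sum, LinearMap.map_smul, smul_eq_mul]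
    have h2 : ∀ s' : Finset ι, ∀ᵐ ω ∂P, (∑ i ∈ s', (c * f (x i)) * g (x i) : L0 P) ω =
        c ω * ∑ i ∈ s', f (x i) ω * g (x i) ω := by
      classical
      intro s'
      induction s' using Finset.induction_on with
      | empty => filter_upwards [ae_zero (P := P)] with ω h; simp [h]
      | insert i s' his ih =>
        rw [Finset.sum_insert his]
        filter_upwards [ih, ae_add (c * f (x i) * g (x i)) (∑ i ∈ s', c * f (x i) * g (x i)),
          ae_mul (c * f (x i)) (g (x i)), ae_mul c (f (x i))] with ω h1 h2 h3 h4
        rw [h2, h1, h3, h4, Finset.sum_insert his]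
        ring
    rw [h1]
    exact h2 s
  obtain ⟨e, he⟩ := exists_L0 (P := P) (φ := fun ω => z f ω - c ω * Q f ω + ε)
    (((z f).measurable.sub (c.measurable.mul (Q f).measurable)).add_const _)
  have hde : d ≤ e := by
    refine hdist a e fun g hg => ?_
    have hgf : g - f ∈ N.dual := N.dual_sub hg.1 hf.1
    have h1 := hm _ (N.ball_convex hf hg (t := t) (by
      filter_upwards [ht0] with ω h; exact ⟨h.1.le, h.2.1⟩))
    have h2 : z (f + t • (g - f)) = z f + t * (z g - z f) := by
      rw [hz.map_add hf.1 (N.dual_smul t hgf), hz.map_smul hgf]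
      have h3 := hz.map_add hgf hf.1
      rw [sub_add_cancel] at h3
      rw [h3, add_sub_cancel_right]
    have h3 : ∀ i, ∀ᵐ ω ∂P, (f + t • (g - f)) (x i) ω =
        f (x i) ω + t ω * (g (x i) ω - f (x i) ω) := by
      intro i
      filter_upwards [ae_add (f (x i)) (t • (g (x i) - f (x i))), ae_smul t (g (x i) - f (x i)),
        ae_sub (g (x i)) (f (x i))] with ω h4 h5 h6
      rw [LinearMap.add_apply, LinearMap.smul_apply, LinearMap.sub_apply, h4, h5, h6]
    have h4 : ∀ᵐ ω ∂P, z (f + t • (g - f)) ω = z f ω + t ω * (z g ω - z f ω) := by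
      rw [h2]
      filter_upwards [ae_add (z f) (t * (z g - z f)), ae_mul t (z g - z f), ae_sub (z g) (z f)]
        with ω h4 h5 h6
      rw [h4, h5, h6]
    filter_upwards [L0.le_iff.1 h1, L0.le_iff.1 hfm, h4, hJ f, hJ (f + t • (g - f)), hQ f,
      hQ (f + t • (g - f)), (Filter.eventually_all_finset s).2 fun i _ => h3 i,
      ha g, ae_add (J f) η, hη, ht0, hc0, hK, he,
      (Filter.eventually_all_finset s).2 fun i _ => N.mem_dualBall_iff.1 hf (x i),
      (Filter.eventually_all_finset s).2 fun i _ => N.mem_dualBall_iff.1 hg (x i)]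
      with ω b1 b2 b3 b4 b5 b6 b7 b8 b9 b10 b11 b12 b13 b14 b15 b16 b17
    obtain ⟨ht1, ht2, ht3⟩ := b12
    have hsum : Q (f + t • (g - f)) ω = Q f ω + 2 * t ω * (∑ i ∈ s, f (x i) ω * g (x i) ω - Q f ω)
        + t ω ^ 2 * ∑ i ∈ s, (g (x i) ω - f (x i) ω) ^ 2 := by
      rw [b7, b6, ← Finset.sum_sub_distrib, Finset.mul_sum, Finset.mul_sum, ← Finset.sum_add_distrib,
        ← Finset.sum_add_distrib]
      refine Finset.sum_congr rfl fun i hi => ?_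
      rw [b8 i hi]
      ring
    have hR : ∑ i ∈ s, (g (x i) ω - f (x i) ω) ^ 2 ≤ 4 * K ω := by
      rw [b14, Finset.mul_sum]
      refine Finset.sum_le_sum fun i hi => ?_
      have h5 := _root_.abs_le.1 (b16 i hi)
      have h6 := _root_.abs_le.1 (b17 i hi)
      have h7 : |g (x i) ω - f (x i) ω| ≤ 2 * N.toFun (x i) ω := by
        rw [_root_.abs_le]; constructor <;> linarith
      have h8 := pow_le_pow_left₀ (abs_nonneg _) h7 2
      rw [sq_abs] at h8
      linarith
    set R := ∑ i ∈ s, (g (x i) ω - f (x i) ω) ^ 2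
    set D := ∑ i ∈ s, f (x i) ω * g (x i) ω
    rw [b5, b3, hsum] at b1
    rw [b10, b4, b11] at b2
    rw [b9, b15]
    have key : t ω * (z g ω - z f ω - c ω * (D - Q f ω) - c ω / 2 * t ω * R - ε / 2) ≤ 0 := by
      nlinarith
    have key2 : z g ω - z f ω - c ω * (D - Q f ω) - c ω / 2 * t ω * R - ε / 2 ≤ 0 := by
      by_contra h
      exact absurd key (not_le.2 (mul_pos ht1 (not_le.1 h)))
    have key3 : c ω / 2 * t ω * R ≤ c ω / 2 * t ω * (4 * K ω) := by gcongr
    nlinarith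
  have hfin : ∀ᵐ ω ∂P, d ω - ε ≤ z f ω ∧ Q f ω ≤ ε ^ 2 := by
    filter_upwards [L0.le_iff.1 hde, he, hz.abs_le hC hf, L0.nonneg_iff.1 hd, hc0, hQ0 f, hc]
      with ω h1 h2 h3 h4 h5 h6 h7
    rw [h2] at h1
    have h8 : 0 ≤ c ω * Q f ω := by positivity
    have h9 := _root_.abs_le.1 h3
    refine ⟨by linarith, ?_⟩
    have h10 : c ω * Q f ω ≤ |C ω| + ε := by linarith [le_abs_self (C ω)]
    rw [h7, div_mul_eq_mul_div, div_le_iff₀ (by positivity)] at h10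
    have h11 : 0 < |C ω| + ε := by positivity
    exact le_of_mul_le_mul_left h10 h11
  refine ⟨f, hf, fun i hi => ?_, hfin.mono fun _ h => h.1⟩
  filter_upwards [hfin, hQ f] with ω h1 h2
  have h3 : (f (x i) ω) ^ 2 ≤ Q f ω := by
    rw [h2]
    exact Finset.single_le_sum (f := fun i => (f (x i) ω) ^ 2) (fun j _ => sq_nonneg _) hi
  exact abs_le_of_sq_le_sq (h3.trans h1.2) hε.le

end Limits

/-! ### Triangular sequences, subsequences and Simons' inequality. -/

section Sequences

variable {P : Measure Ω} [IsProbabilityMeasure P] {E : Type*} [AddCommGroup E] [Module (L0 P) E]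
  {N : L0Norm P E} {S : Set E} {z : (E →ₗ[L0 P] L0 P) → L0 P}

/-- Sequences of functionals and points with triangular behaviour. -/
theorem IsLimitOf.exists_seq (hz : IsLimitOf N S z) {C : L0 P}
    (hC : ∀ x ∈ S, ∀ᵐ ω ∂P, N.toFun x ω ≤ C ω) {d : L0 P} (hd : 0 ≤ d)
    (hdist : ∀ (x : E) (b : L0 P), (∀ f ∈ N.dualBall, ∀ᵐ ω ∂P, z f ω - f x ω ≤ b ω) → d ≤ b)
    {ε : ℝ} (hε : 0 < ε) :
    ∃ (f : ℕ → E →ₗ[L0 P] L0 P) (x : ℕ → E), (∀ n, f n ∈ N.dualBall) ∧ (∀ n, x n ∈ S) ∧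
      (∀ i j, i < j → ∀ᵐ ω ∂P, |f j (x i) ω| ≤ 1 / ((j : ℝ) + 1)) ∧
      ∀ i k : ℕ, i ≤ k → ∀ᵐ ω ∂P, d ω - ε - 1 / ((k : ℝ) + 1) ≤ f i (x k) ω := by
  classical
  obtain ⟨a, haP, har⟩ := exists_seq_of_forall_finset_exists
    (α := (E →ₗ[L0 P] L0 P) × E × ℕ)
    (fun a => a.1 ∈ N.dualBall ∧ a.2.1 ∈ S ∧ (∀ᵐ ω ∂P, d ω - ε ≤ z a.1 ω) ∧
      ∀ᵐ ω ∂P, |a.1 a.2.1 ω - z a.1 ω| ≤ 1 / ((a.2.2 : ℝ) + 1))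
    (fun a b => a.2.2 < b.2.2 ∧ (∀ᵐ ω ∂P, |b.1 a.2.1 ω| ≤ 1 / ((b.2.2 : ℝ) + 1)) ∧
      ∀ᵐ ω ∂P, |a.1 b.2.1 ω - z a.1 ω| ≤ 1 / ((b.2.2 : ℝ) + 1)) (by
    intro s hs
    -- Each triple records a functional, a point and an accuracy level. The level exceeds all
    -- earlier ones, hence is at least the position in the sequence. The functional is small at
    -- earlier points, and the point approximates `z` at all functionals so far.
    let k : ℕ := s.sup (fun a => a.2.2) + 1
    have hk : (0 : ℝ) < 1 / ((k : ℝ) + 1) := by positivity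
    obtain ⟨f, hf, hfx, hfz⟩ := hz.helly hC hd hdist s (fun a => a.2.1) (lt_min hε hk)
    obtain ⟨e, he, he'⟩ := exists_pos_const P hk
    obtain ⟨x, hx, hx'⟩ := hz (insert f (s.image Prod.fst)) (by
      intro g hg
      rcases Finset.mem_insert.1 hg with rfl | hg
      · exact hf.1
      · obtain ⟨b, hb, rfl⟩ := Finset.mem_image.1 hg
        exact (hs b hb).1.1) e he
    refine ⟨(f, x, k), ⟨hf, hx, ?_, ?_⟩, fun b hb => ⟨?_, ?_, ?_⟩⟩
    · filter_upwards [hfz] with ω h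
      linarith [min_le_left ε (1 / ((k : ℝ) + 1))]
    · filter_upwards [hx' f (by simp), he'] with ω h1 h2
      rwa [h2] at h1
    · exact Nat.lt_succ_of_le (Finset.le_sup (f := fun a => a.2.2) hb)
    · filter_upwards [hfx b hb] with ω h
      exact h.trans (min_le_right _ _)
    · filter_upwards [hx' b.1 (Finset.mem_insert_of_mem (Finset.mem_image_of_mem _ hb)), he']
        with ω h1 h2
      rwa [h2] at h1)
  have hmono : StrictMono fun n => (a n).2.2 := fun m n h => (har m n h).1
  have hle : ∀ n : ℕ, 1 / (((a n).2.2 : ℝ) + 1) ≤ 1 / ((n : ℝ) + 1) := by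
    intro n
    have h1 : n ≤ (a n).2.2 := hmono.le_apply
    gcongr
  refine ⟨fun n => (a n).1, fun n => (a n).2.1, fun n => (haP n).1, fun n => (haP n).2.1,
    fun i j hij => ?_, fun i k hik => ?_⟩
  · filter_upwards [(har i j hij).2.1] with ω h
    exact h.trans (hle j)
  · have h1 : ∀ᵐ ω ∂P, |(a i).1 (a k).2.1 ω - z (a i).1 ω| ≤ 1 / (((a k).2.2 : ℝ) + 1) := by
      rcases hik.eq_or_lt with rfl | h
      · exact (haP i).2.2.2
      · exact (har i k h).2.2
    filter_upwards [h1, (haP i).2.2.1] with ω h2 h3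
    have h4 := (_root_.abs_le.1 h2).1
    linarith [hle k]

/-- Sequences in the dual ball have stable subsequences that converge pointwise a.e. -/
theorem exists_subseq (hball : IsStableSeqCompact P (weakStarTopology P E) N.dualBall)
    {f : ℕ → E →ₗ[L0 P] L0 P} (hf : ∀ n, f n ∈ N.dualBall) :
    ∃ (ν : ℕ → L0N P) (h : ℕ → E →ₗ[L0 P] L0 P), ∃ g ∈ N.dualBall, (∀ j, h j ∈ N.dualBall) ∧
      (∀ j, ∀ᵐ ω ∂P, j ≤ ν j ω) ∧ (∀ j x, ∀ᵐ ω ∂P, h j x ω = f (ν j ω) x ω) ∧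
      ∀ x, ∀ᵐ ω ∂P, Filter.Tendsto (fun j => h j x ω) Filter.atTop (nhds (g x ω)) := by
  -- The sequence is extended to random indices by gluing, as stable sequential compactness
  -- requires.
  have hX : ∀ n : L0N P, ∃ X ∈ N.dualBall, ∀ x, ∀ᵐ ω ∂P, X x ω = f (n ω) x ω := by
    intro n
    obtain ⟨X, hX, hX'⟩ := N.glues_dualBall (levels n) f hf
    refine ⟨X, hX, fun x => (levels n).ae_of_forall fun k => ?_⟩
    have h1 : AgreeOn (P := P) ((levels n).measurableSet k) X (f k) := hX' k
    filter_upwards [agreeOn_L0.1 (agreeOn_linearMap.1 h1 x)] with ω h2 hω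
    rw [h2 hω, show n ω = k from hω]
  choose X hXb hX using hX
  obtain ⟨n, ⟨hn, hn'⟩, g, hg, hlim⟩ := hball X (by
    intro a k m _ _ hm j
    refine agreeOn_linearMap.2 fun x => agreeOn_L0.2 ?_
    filter_upwards [hm j, hX m x, hX (k j) x] with ω h1 h2 h3 hω
    rw [h2, h3, h1 hω]) hXb
  choose c hc using fun j : ℕ => exists_L0N (P := P) (φ := fun _ => j) measurable_const
  refine ⟨fun j => n (c j), fun j => X (n (c j)), g, hg, fun j => hXb _, fun j => ?_,
    fun j x => hX _ x, fun x => ?_⟩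
  · induction j with
    | zero => exact Filter.Eventually.of_forall fun ω => Nat.zero_le _
    | succ j ih =>
      have h1 := hn' (c j) (c (j + 1)) (by
        filter_upwards [hc j, hc (j + 1)] with ω h1 h2
        rw [h1, h2]; exact Nat.lt_succ_self j)
      filter_upwards [ih, h1] with ω h2 h3
      omega
  · have hK : ∀ m : ℕ, ∃ K : L0N P, ∀ k, K ≤ k →
        ∀ᵐ ω ∂P, |g x ω - X (n k) x ω| < 1 / ((m : ℝ) + 1) := by
      intro m
      obtain ⟨e, he, he'⟩ := exists_pos_const P (c := 1 / ((m : ℝ) + 1)) (by positivity)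
      have h1 := basicNhd_mem_nhds (P := P) (Q := {p | ∃ x : E, p = fun f : E →ₗ[L0 P] L0 P => |f x|})
        (p := fun f : E →ₗ[L0 P] L0 P => |f x|) ⟨x, rfl⟩ (by simp) g he
      obtain ⟨K, hK⟩ := Filter.mem_atTop_sets.1 (hlim h1)
      refine ⟨K, fun k hk => ?_⟩
      have h2 : ∀ᵐ ω ∂P, |(g - X (n k)) x| ω < e ω := hK k hk
      filter_upwards [h2, he', ae_abs ((g - X (n k)) x), ae_sub (g x) (X (n k) x)]
        with ω h3 h4 h5 h6
      rw [h5, LinearMap.sub_apply, h6, h4] at h3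
      exact h3
    choose K hK using hK
    -- A constant index need not dominate the random threshold `K m`. By stability the terms at `c
    -- j` and `c j ⊔ K m` agree on `{K m ≤ j}`.
    have hj : ∀ m j : ℕ, ∀ᵐ ω ∂P, K m ω ≤ j → |g x ω - X (n (c j)) x ω| < 1 / ((m : ℝ) + 1) := by
      intro m j
      obtain ⟨κ, hκ⟩ := exists_L0N (P := P) (φ := fun ω => if K m ω ≤ j then 0 else 1)
        (Measurable.ite (measurableSet_le (K m).measurable measurable_const) measurable_const
          measurable_const)
      have h1 := hn (levels κ) (fun i => if i = 0 then c j else c j ⊔ K m) (c j ⊔ K m) (by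
        intro i
        by_cases hi : i = 0
        · subst hi
          simp only [if_true]
          filter_upwards [hκ, AEEqFun.coeFn_sup (c j) (K m), hc j] with ω h1 h2 h3 hω
          have h4 : κ ω = 0 := hω
          rw [h4] at h1
          split_ifs at h1 with h5
          rw [h2, h3]
          exact max_eq_left h5
        · simp [hi])
      have h2 := h1 0
      simp only [if_true] at h2
      filter_upwards [h2, hκ, hK m (c j ⊔ K m) le_sup_right, hX (n (c j)) x,
        hX (n (c j ⊔ K m)) x] with ω h3 h4 h5 h6 h7 h8
      rw [if_pos h8] at h4
      rw [h6, ← h3 h4, ← h7]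
      exact h5
    filter_upwards [ae_all_iff.2 fun m => ae_all_iff.2 (hj m)] with ω hω
    rw [Metric.tendsto_atTop]
    intro ε hε
    obtain ⟨m, hm⟩ := exists_nat_one_div_lt hε
    refine ⟨K m ω, fun j hj => ?_⟩
    rw [Real.dist_eq, abs_sub_comm]
    exact (hω m j hj).trans hm

/-- A version of Simons' inequality. -/
theorem exists_simons (hatt : ∀ f ∈ N.dual, ∃ y ∈ S, IsLUB (f '' S) (f y))
    {C : ℕ → Set (E →ₗ[L0 P] L0 P)} (hCd : ∀ n, C n ⊆ N.dual) (hCne : ∀ n, (C n).Nonempty)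
    (hCg : ∀ n, Glues P (C n)) (hCb : ∀ n x, ∃ b : L0 P, ∀ u ∈ C n, b ≤ u x)
    (hw : ∀ y : ℕ → E →ₗ[L0 P] L0 P, (∀ n, y n ∈ C n) →
      ∃ w : ℕ → E →ₗ[L0 P] L0 P, (∀ n, w n ∈ C n) ∧ ∀ n, w n + w n = y n + w (n + 1))
    {δ : ℝ} (hδ : 0 < δ) :
    ∃ w : ℕ → E →ₗ[L0 P] L0 P, (∀ n, w n ∈ C n) ∧ ∃ b ∈ S, (∀ x ∈ S, w 0 x ≤ w 0 b) ∧
      ∀ n, ∀ᵐ ω ∂P, w 0 b ω - δ ≤ w n b ω := by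
  obtain ⟨x₀, hx₀, -⟩ := hatt 0 N.dual_zero
  have hpt : ∀ u : E →ₗ[L0 P] L0 P, ∃ y ∈ S, u ∈ N.dual → ∀ x ∈ S, u x ≤ u y := by
    intro u
    by_cases h : u ∈ N.dual
    · obtain ⟨y, hy, hy'⟩ := hatt u h
      exact ⟨y, hy, fun _ x hx => hy'.1 (Set.mem_image_of_mem u hx)⟩
    · exact ⟨x₀, hx₀, fun h' => absurd h' h⟩
  choose pt hptS hpt using hpt
  -- For fixed `v`, the supremum of `v + y` over `S` is local in `y`, since it is attained at one
  -- point on all of `Ω`; hence almost minimisers exist. The tolerances add up to `δ`.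
  have hmin : ∀ (n : ℕ) (v : E →ₗ[L0 P] L0 P), ∃ y ∈ C n, v ∈ N.dual → ∀ y' ∈ C n,
      ∀ᵐ ω ∂P, (v + y) (pt (v + y)) ω ≤ (v + y') (pt (v + y')) ω + δ * (1 / 2) ^ (n + 1) := by
    intro n v
    by_cases hv : v ∈ N.dual
    swap
    · obtain ⟨y, hy⟩ := hCne n
      exact ⟨y, hy, fun h => absurd h hv⟩
    have hloc : LocalOn P (C n) fun y => (v + y) (pt (v + y)) := by
      intro A hA y y' hy hy' h
      have h1 : ∀ x, ∀ᵐ ω ∂P, ω ∈ A → (v + y) x ω = (v + y') x ω := fun x =>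
        agreeOn_L0.1 (agreeOn_linearMap.1 ((AgreeOn.refl hA v).add h) x)
      filter_upwards [h1 (pt (v + y)), h1 (pt (v + y')),
        L0.le_iff.1 (hpt (v + y) (N.dual_add hv (hCd n hy)) _ (hptS (v + y'))),
        L0.le_iff.1 (hpt (v + y') (N.dual_add hv (hCd n hy')) _ (hptS (v + y)))]
        with ω h2 h3 h4 h5 hω
      rw [← h2 hω] at h5
      rw [h3 hω] at h4
      exact le_antisymm h5 h4
    obtain ⟨b, hb⟩ := hCb n x₀
    obtain ⟨g, -, hg, hg'⟩ := exists_almost_min (hCne n) (hCg n) hloc (b := v x₀ + b) (fun y hy =>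
      (add_le_add_right (hb y hy) (v x₀)).trans (hpt (v + y) (N.dual_add hv (hCd n hy)) x₀ hx₀))
    obtain ⟨e, he, he'⟩ := exists_pos_const P (c := δ * (1 / 2) ^ (n + 1)) (by positivity)
    obtain ⟨y, hy, hyg⟩ := hg' e he
    refine ⟨y, hy, fun _ y' hy' => ?_⟩
    filter_upwards [L0.le_iff.1 hyg, L0.le_iff.1 (hg y' hy'), he', ae_add g e] with ω h1 h2 h3 h4
    rw [h4, h3] at h1
    linarith
  choose Y hYC hY using hmin
  let v : ℕ → E →ₗ[L0 P] L0 P := fun n => Nat.rec 0 (fun n v => v + v + Y n v) n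
  have hvs : ∀ n, v (n + 1) = v n + v n + Y n (v n) := fun n => rfl
  have hvd : ∀ n, v n ∈ N.dual := by
    intro n
    induction n with
    | zero => exact N.dual_zero
    | succ n ih => exact N.dual_add (N.dual_add ih ih) (hCd n (hYC n _))
  obtain ⟨w, hwC, hww⟩ := hw (fun n => Y n (v n)) fun n => hYC n _
  -- Since `v (n + 1) = 2 v n + y n` and `2 w n = y n + w (n + 1)`, the sum `v n + w n` doubles at
  -- each step.
  have hrel : ∀ n, (2 ^ n : ℕ) • w 0 = v n + w n := by
    intro n
    induction n with
    | zero => simp [v]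
    | succ n ih =>
      rw [pow_succ, mul_two, add_smul, ih, hvs]
      have := hww n
      calc v n + w n + (v n + w n) = v n + v n + (w n + w n) := by abel
        _ = _ := by rw [this]; abel
  have hsm : ∀ (n : ℕ) x, ∀ᵐ ω ∂P, (v n + w n) x ω = 2 ^ n * w 0 x ω := by
    intro n x
    rw [← hrel n, LinearMap.smul_apply]
    filter_upwards [AEEqFun.coeFn_smul (2 ^ n : ℕ) (w 0 x)] with ω h
    rw [h, Pi.smul_apply, nsmul_eq_mul]
    push_cast
    rfl
  have hw0 := hpt (w 0) (hCd 0 (hwC 0))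
  refine ⟨w, hwC, pt (w 0), hptS _, hw0, fun n => ?_⟩
  -- Writing `v (n + 1) = v n + (v n + y n)`, almost minimality compares `y n` with `w n`, and the
  -- supremum of `v n + w n` is `2ⁿ` times that of `w 0`. Subtracting `v n` from `2ⁿ w 0` at the
  -- maximiser then bounds `w n` from below.
  have hp : ∀ n, ∀ᵐ ω ∂P, v n (pt (v n)) ω ≤
      (2 ^ n - 1) * w 0 (pt (w 0)) ω + δ * (1 - (1 / 2) ^ n) := by
    intro n
    induction n with
    | zero =>
      filter_upwards [ae_zero (P := P)] with ω h
      have : v 0 (pt (v 0)) = 0 := rfl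
      rw [this, h]
      simp
    | succ n ih =>
      have hvy := N.dual_add (hvd n) (hCd n (hYC n (v n)))
      set q := pt (v (n + 1))
      have hq : v (n + 1) q = v n q + (v n + Y n (v n)) q := by
        rw [hvs, add_assoc, LinearMap.add_apply]
      filter_upwards [ih, hY n (v n) (hvd n) (w n) (hwC n), hsm n (pt (v n + w n)),
        L0.le_iff.1 (hw0 (pt (v n + w n)) (hptS _)), ae_add (v n q) ((v n + Y n (v n)) q),
        L0.le_iff.1 (hpt (v n) (hvd n) q (hptS _)),
        L0.le_iff.1 (hpt (v n + Y n (v n)) hvy q (hptS _))] with ω h1 h2 h3 h4 h5 h6 h7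
      rw [hq, h5]
      rw [h3] at h2
      have h8 : (2 : ℝ) ^ n * w 0 (pt (v n + w n)) ω ≤ 2 ^ n * w 0 (pt (w 0)) ω := by gcongr
      have h9 : (2 : ℝ) ^ (n + 1) = 2 ^ n + 2 ^ n := by ring
      have h10 : δ * (1 - (1 / 2 : ℝ) ^ (n + 1)) = δ * (1 - (1 / 2) ^ n) + δ * (1 / 2) ^ (n + 1) := by
        ring
      rw [h9, h10]
      linarith
  filter_upwards [hp n, hsm n (pt (w 0)), ae_add (v n (pt (w 0))) (w n (pt (w 0))),
    L0.le_iff.1 (hpt (v n) (hvd n) (pt (w 0)) (hptS _))] with ω h1 h2 h3 h4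
  rw [LinearMap.add_apply, h3] at h2
  have h5 : 0 ≤ δ * (1 / 2 : ℝ) ^ n := by positivity
  nlinarith

end Sequences

/-! ### Convex series and James' argument. -/

theorem hasSum_half_pow_succ : HasSum (fun k : ℕ => (1 / 2 : ℝ) ^ (k + 1)) 1 := by
  have := hasSum_geometric_two.mul_right (1 / 2 : ℝ)
  simpa [pow_succ] using this

/-- Lower bounds for lower limits pass to convex series of uniformly bounded sequences. -/
theorem eventually_le_of_hasSum {y : ℕ → ℕ → ℝ} {w : ℕ → ℝ} {b θ : ℝ} (hb : ∀ j k, |y j k| ≤ b)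
    (hw : ∀ k, HasSum (fun j => (1 / 2) ^ (j + 1) * y j k) (w k))
    (hy : ∀ j, ∀ ε : ℝ, 0 < ε → ∀ᶠ k in Filter.atTop, θ - ε ≤ y j k) {ε : ℝ} (hε : 0 < ε) :
    ∀ᶠ k in Filter.atTop, θ - ε ≤ w k := by
  have hb0 : 0 ≤ b := (abs_nonneg _).trans (hb 0 0)
  -- The terms from `M` on are at most `2⁻ᴹ b` in total, and the first `M` weights miss mass `2⁻ᴹ`;
  -- this `M` absorbs both errors in `ε / 2`.
  obtain ⟨M, hM⟩ := exists_pow_lt_of_lt_one (show 0 < ε / 2 / (b + |θ| + ε) by positivity)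
    (show (1 / 2 : ℝ) < 1 by norm_num)
  rw [lt_div_iff₀ (by positivity)] at hM
  have h1 : ∀ᶠ k in Filter.atTop, ∀ j ∈ Finset.range M, θ - ε / 2 ≤ y j k :=
    (Filter.eventually_all_finset _).2 fun j _ => hy j (ε / 2) (by positivity)
  have hgeo : ∑ j ∈ Finset.range M, (1 / 2 : ℝ) ^ (j + 1) = 1 - (1 / 2) ^ M := by
    have := geom_sum_eq (show (1 / 2 : ℝ) ≠ 1 by norm_num) M
    simp_rw [pow_succ]
    rw [← Finset.sum_mul, this]
    ring
  filter_upwards [h1] with k hk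
  have h2 := (hasSum_nat_add_iff' M).2 (hw k)
  have h3 : HasSum (fun j : ℕ => (1 / 2 : ℝ) ^ (j + 1) * ((1 / 2) ^ M * b)) (1 * ((1 / 2) ^ M * b)) :=
    hasSum_half_pow_succ.mul_right _
  have h4 := h2.norm_le_of_bounded h3 fun j => by
    rw [Real.norm_eq_abs, abs_mul, abs_of_pos (by positivity)]
    have h5 : (1 / 2 : ℝ) ^ (j + M + 1) = (1 / 2) ^ (j + 1) * (1 / 2) ^ M := by ring
    rw [h5, mul_assoc]
    gcongr
    exact hb _ _
  have h6 : (1 - (1 / 2 : ℝ) ^ M) * (θ - ε / 2) ≤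
      ∑ j ∈ Finset.range M, (1 / 2) ^ (j + 1) * y j k := by
    rw [← hgeo, Finset.sum_mul]
    refine Finset.sum_le_sum fun j hj => ?_
    gcongr
    exact hk j hj
  rw [Real.norm_eq_abs, one_mul] at h4
  have h7 := (abs_le.1 h4).1
  have h8 : (0 : ℝ) < (1 / 2) ^ M := by positivity
  nlinarith [le_abs_self θ, mul_le_mul_of_nonneg_left (le_abs_self θ) h8.le, mul_pos h8 hε]

section James

variable {P : Measure Ω} [IsProbabilityMeasure P] {E : Type*} [AddCommGroup E] [Module (L0 P) E]
  {N : L0Norm P E} {S : Set E} {z : (E →ₗ[L0 P] L0 P) → L0 P}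

omit [IsProbabilityMeasure P] in
/-- The series `∑ 2^{-k-1} y_{n+k}`. -/
theorem L0Norm.exists_tail_sums (N : L0Norm P E) {y : ℕ → E →ₗ[L0 P] L0 P}
    (hy : ∀ k x, ∀ᵐ ω ∂P, |y k x ω| ≤ 2 * N.toFun x ω) :
    ∃ w : ℕ → E →ₗ[L0 P] L0 P,
      (∀ n x, ∀ᵐ ω ∂P, HasSum (fun k => (1 / 2) ^ (k + 1) * y (n + k) x ω) (w n x ω)) ∧
      ∀ n, w n + w n = y n + w (n + 1) := by
  choose e he he' using fun k : ℕ =>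
    exists_pos_const P (c := (1 / 2 : ℝ) ^ (k + 1)) (by positivity)
  have hey : ∀ n k x, ∀ᵐ ω ∂P, (e k • y (n + k)) x ω = (1 / 2) ^ (k + 1) * y (n + k) x ω := by
    intro n k x
    filter_upwards [ae_smul (e k) (y (n + k) x), he' k] with ω h1 h2
    rw [LinearMap.smul_apply, h1, h2]
  have hex : ∀ n, ∃ w : E →ₗ[L0 P] L0 P, ∀ x, ∀ᵐ ω ∂P,
      HasSum (fun k => (1 / 2) ^ (k + 1) * y (n + k) x ω) (w x ω) := by
    intro n
    obtain ⟨w, hw⟩ := N.exists_hasSum (fun k => e k • y (n + k))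
      (hasSum_half_pow_succ.summable.mul_right 2) (by
      intro k x
      filter_upwards [hey n k x, hy (n + k) x] with ω h1 h2
      rw [h1, abs_mul, abs_of_pos (by positivity), mul_assoc]
      gcongr)
    refine ⟨w, fun x => ?_⟩
    filter_upwards [hw x, ae_all_iff.2 fun k => hey n k x] with ω h1 h2
    simpa only [h2] using h1
  choose w hw using hex
  refine ⟨w, hw, fun n => LinearMap.ext fun x => L0.eq_iff.2 ?_⟩
  filter_upwards [hw n x, hw (n + 1) x, ae_add (w n x) (w n x), ae_add (y n x) (w (n + 1) x)]
    with ω h1 h2 h3 h4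
  rw [LinearMap.add_apply, LinearMap.add_apply, h3, h4]
  have h5 := (hasSum_nat_add_iff' 1).2 h1
  have h6 : HasSum (fun k => (1 / 2 : ℝ) ^ (k + 1 + 1) * y (n + (k + 1)) x ω)
      (1 / 2 * w (n + 1) x ω) := by
    have h := h2.mul_left (1 / 2 : ℝ)
    have e : (fun k => (1 / 2 : ℝ) ^ (k + 1 + 1) * y (n + (k + 1)) x ω) =
        fun k => 1 / 2 * ((1 / 2) ^ (k + 1) * y (n + 1 + k) x ω) := by
      funext k
      rw [show n + (k + 1) = n + 1 + k by omega, pow_succ _ (k + 1)]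
      ring
    rw [e]
    exact h
  have h7 := h5.unique h6
  simp at h7
  linarith

/-- Under James' condition, weak-* limits of `S` in the bidual have distance zero from `E`. -/
theorem IsLimitOf.dist_eq_zero (hz : IsLimitOf N S z)
    (hball : IsStableSeqCompact P (weakStarTopology P E) N.dualBall)
    (hatt : ∀ f ∈ N.dual, ∃ y ∈ S, IsLUB (f '' S) (f y)) {C : L0 P}
    (hC : ∀ x ∈ S, ∀ᵐ ω ∂P, N.toFun x ω ≤ C ω) {d : L0 P} (hd : 0 ≤ d)
    (hdist : ∀ (x : E) (b : L0 P), (∀ f ∈ N.dualBall, ∀ᵐ ω ∂P, z f ω - f x ω ≤ b ω) → d ≤ b) :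
    d = 0 := by
  have main : ∀ ε : ℝ, 0 < ε → ∀ᵐ ω ∂P, d ω ≤ 2 * ε := by
    intro ε hε
    obtain ⟨f, x, hf, hx, hfx, hfx'⟩ := hz.exists_seq hC hd hdist hε
    obtain ⟨ν, h, g, hg, hh, hν, hhν, hlim⟩ := exists_subseq hball hf
    rw [N.mem_dualBall_iff] at hg
    have hh' := fun j => N.mem_dualBall_iff.1 (hh j)
    -- As `ν j ≥ j`, the values `h j (x k)` are eventually of the small triangular kind.
    have hgx : ∀ᵐ ω ∂P, ∀ k, g (x k) ω = 0 := by
      rw [ae_all_iff]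
      intro k
      filter_upwards [hlim (x k), ae_all_iff.2 hν, ae_all_iff.2 fun j => hhν j (x k),
        ae_all_iff.2 fun j => ae_all_iff.2 fun hj : k < j => hfx k j hj] with ω h1 h2 h3 h4
      refine tendsto_nhds_unique h1 ?_
      refine squeeze_zero_norm' (a := fun j : ℕ => 1 / ((j : ℝ) + 1)) ?_
        tendsto_one_div_add_atTop_nhds_zero_nat
      filter_upwards [Filter.eventually_gt_atTop k] with j hj
      rw [h3 j, Real.norm_eq_abs]
      refine (h4 _ (hj.trans_le (h2 j))).trans ?_
      have := h2 j
      gcongr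
    have hhx : ∀ j, ∀ᵐ ω ∂P, ∀ η : ℝ, 0 < η → ∀ᶠ k in Filter.atTop,
        d ω - ε - η ≤ (h j - g) (x k) ω := by
      intro j
      filter_upwards [hgx, ae_all_iff.2 fun k => hhν j (x k),
        ae_all_iff.2 fun k => ae_sub (h j (x k)) (g (x k)),
        ae_all_iff.2 fun i => ae_all_iff.2 fun k => ae_all_iff.2 fun hk : i ≤ k => hfx' i k hk]
        with ω h1 h2 h3 h4 η hη
      obtain ⟨m, hm⟩ := exists_nat_one_div_lt hη
      filter_upwards [Filter.eventually_ge_atTop (max m (ν j ω))] with k hk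
      rw [LinearMap.sub_apply, h3, h1, h2, sub_zero]
      have h5 := h4 _ k ((le_max_right _ _).trans hk)
      have h6 : 1 / ((k : ℝ) + 1) ≤ 1 / ((m : ℝ) + 1) := by
        have := (le_max_left _ _).trans hk
        gcongr
      linarith
    -- These inequalities stand in for the infinite convex hull of the `h i - g` with `i ≥ n`. They
    -- are local and survive convex series, as Simons' inequality requires.
    let D : ℕ → Set (E →ₗ[L0 P] L0 P) := fun n => {u |
      (∀ v, ∀ᵐ ω ∂P, |u v ω| ≤ 2 * N.toFun v ω) ∧
      (∀ v, ∀ᵐ ω ∂P, ∀ c : ℝ, (∀ i, n ≤ i → (h i - g) v ω ≤ c) → u v ω ≤ c) ∧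
      ∀ᵐ ω ∂P, ∀ η : ℝ, 0 < η → ∀ᶠ k in Filter.atTop, d ω - ε - η ≤ u (x k) ω}
    obtain ⟨two, -, htwo⟩ := exists_pos_const P (c := 2) two_pos
    obtain ⟨w, hwD, b, hb, hwb, hwn⟩ := exists_simons (C := D) hatt
      (fun n u hu => N.mem_dual_iff.2 ⟨two, fun v => by
        filter_upwards [hu.1 v, htwo] with ω h1 h2
        rwa [h2]⟩)
      (fun n => ⟨h n - g, fun v => by
        filter_upwards [hh' n v, hg v, ae_sub (h n v) (g v)] with ω h1 h2 h3
        rw [LinearMap.sub_apply, h3]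
        have h4 := abs_sub (h n v ω) (g v ω)
        linarith, fun v => Filter.Eventually.of_forall fun ω c hc => hc n le_rfl, hhx n⟩)
      (fun n a u hu => by
        obtain ⟨y, hy⟩ := exists_glue_linearMap a u
        have hy' : ∀ k v, ∀ᵐ ω ∂P, ω ∈ a.part k → y v ω = u k v ω := fun k v =>
          agreeOn_L0.1 (agreeOn_linearMap.1 (hy k) v)
        refine ⟨y, ⟨fun v => a.ae_of_forall fun k => ?_, fun v => a.ae_of_forall fun k => ?_,
          a.ae_of_forall fun k => ?_⟩, hy⟩
        · filter_upwards [hy' k v, (hu k).1 v] with ω h1 h2 hω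
          rwa [h1 hω]
        · filter_upwards [hy' k v, (hu k).2.1 v] with ω h1 h2 hω
          rwa [h1 hω]
        · filter_upwards [ae_all_iff.2 fun j => hy' k (x j), (hu k).2.2] with ω h1 h2 hω η hη
          filter_upwards [h2 η hη] with j hj
          rwa [h1 j hω])
      (fun n v => by
        obtain ⟨c, hc⟩ := exists_L0 (P := P) ((N.toFun v).measurable.const_mul (-2))
        refine ⟨c, fun u hu => L0.le_iff.2 ?_⟩
        filter_upwards [hc, hu.1 v] with ω h1 h2
        rw [h1]
        linarith [(_root_.abs_le.1 h2).1])
      (fun y hy => by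
        obtain ⟨w, hw, hww⟩ := N.exists_tail_sums fun k => (hy k).1
        refine ⟨w, fun n => ⟨fun v => ?_, fun v => ?_, ?_⟩, hww⟩
        · filter_upwards [hw n v, ae_all_iff.2 fun k => (hy (n + k)).1 v] with ω h1 h2
          have h3 := h1.norm_le_of_bounded (hasSum_half_pow_succ.mul_right (2 * N.toFun v ω))
            fun k => by
              rw [Real.norm_eq_abs, abs_mul, abs_of_pos (by positivity)]
              gcongr
              exact h2 k
          rwa [one_mul] at h3
        · filter_upwards [hw n v, ae_all_iff.2 fun k => (hy (n + k)).2.1 v] with ω h1 h2 c hc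
          have h3 := hasSum_le (fun k => by
            show (1 / 2 : ℝ) ^ (k + 1) * y (n + k) v ω ≤ (1 / 2) ^ (k + 1) * c
            gcongr
            exact h2 k c fun i hi => hc i ((Nat.le_add_right n k).trans hi)) h1
            (hasSum_half_pow_succ.mul_right c)
          rwa [one_mul] at h3
        · filter_upwards [ae_all_iff.2 fun k => hw n (x k), ae_all_iff.2 fun j => (hy (n + j)).2.2,
            ae_all_iff.2 fun j => ae_all_iff.2 fun k => (hy (n + j)).1 (x k),
            ae_all_iff.2 fun k => hC (x k) (hx k)] with ω h1 h2 h3 h4 η hη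
          exact eventually_le_of_hasSum (b := 2 * C ω)
            (fun j k => (h3 j k).trans (by linarith [h4 k])) h1 h2 hη) hε
    filter_upwards [ae_all_iff.2 hwn, (hwD 0).2.2, ae_all_iff.2 fun n => (hwD n).2.1 b, hlim b,
      ae_all_iff.2 fun k => L0.le_iff.1 (hwb (x k) (hx k)),
      ae_all_iff.2 fun i => ae_sub (h i b) (g b)] with ω h1 h2 h3 h4 h5 h6
    refine le_of_forall_pos_le_add fun η hη => ?_
    -- At the maximiser, `w 0 b ≥ w 0 (x k) ≥ d - ε - η / 2`, while for large `n` one has `w 0 b - ε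
    -- ≤ w n b ≤ η / 2`.
    obtain ⟨k, hk⟩ := (h2 (η / 2) (by positivity)).exists
    have h7 : Filter.Tendsto (fun i => h i b ω - g b ω) Filter.atTop (nhds (g b ω - g b ω)) :=
      h4.sub_const _
    rw [sub_self] at h7
    obtain ⟨n, hn⟩ := Filter.eventually_atTop.1 (h7.eventually_le_const (half_pos hη))
    have h8 := h3 n (η / 2) fun i hi => by
      rw [LinearMap.sub_apply, h6]
      exact hn i hi
    linarith [h1 n, h5 k]
  rw [L0.eq_iff]
  filter_upwards [ae_all_iff.2 fun n : ℕ => main (1 / ((n : ℝ) + 1)) (by positivity),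
    L0.nonneg_iff.1 hd, ae_zero (P := P)] with ω h1 h2 h3
  rw [h3]
  refine le_antisymm ?_ h2
  have h4 : Filter.Tendsto (fun n : ℕ => 2 * (1 / ((n : ℝ) + 1))) Filter.atTop (nhds (2 * 0)) :=
    tendsto_one_div_add_atTop_nhds_zero_nat.const_mul _
  rw [mul_zero] at h4
  exact ge_of_tendsto' h4 h1

/-- In a stable complete module, a functional on the dual with distance zero from the module is
represented by an element. -/
theorem IsLimitOf.exists_represented (hE : IsStableModule P E) (hN : N.IsStableComplete)
    (hz : IsLimitOf N S z)
    (h0 : ∀ n : ℕ, ∃ x : E, ∀ f ∈ N.dualBall, ∀ᵐ ω ∂P, |z f ω - f x ω| ≤ 1 / ((n : ℝ) + 1)) :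
    ∃ x : E, ∀ f ∈ N.dual, z f = f x := by
  choose x hx using h0
  -- Gluing the approximants along random indices gives the stable sequence that completeness needs;
  -- norming functionals show that it is Cauchy.
  choose X hX hX' using fun n : L0N P => hE (levels n) x
  have hXlev : ∀ n k, AgreeOn (P := P) ((levels n).measurableSet k) (X n) (x k) := fun n k => hX n k
  have hzX : ∀ n, ∀ f ∈ N.dualBall, ∀ᵐ ω ∂P, |z f ω - f (X n) ω| ≤ 1 / ((n ω : ℝ) + 1) := by
    intro n f hf
    refine (levels n).ae_of_forall fun k => ?_
    filter_upwards [agreeOn_L0.1 ((hXlev n k).map f), hx k f hf] with ω h1 h2 hω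
    rw [h1 hω, show n ω = k from hω]
    exact h2
  have hnorm : ∀ n m, ∀ᵐ ω ∂P,
      N.toFun (X n - X m) ω ≤ 1 / ((n ω : ℝ) + 1) + 1 / ((m ω : ℝ) + 1) := by
    intro n m
    obtain ⟨f, hf, hfx⟩ := N.exists_norming (X n - X m)
    rw [← hfx, map_sub]
    filter_upwards [hzX n f hf, hzX m f hf, ae_sub (f (X n)) (f (X m))] with ω h1 h2 h3
    rw [h3]
    linarith [(_root_.abs_le.1 h1).1, (_root_.abs_le.1 h2).2]
  obtain ⟨y, hy⟩ := hN X (by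
    intro a k m _ _ hm j
    refine agreeOn_of_partition hE (levels m) fun i => ?_
    have h1 := (hXlev m i).mono ((a.measurableSet j).inter ((levels m).measurableSet i))
      (Filter.Eventually.of_forall fun ω h => h.2)
    have h2 := (hXlev (k j) i).mono ((a.measurableSet j).inter ((levels m).measurableSet i)) (by
      filter_upwards [hm j] with ω h hω
      have h3 : m ω = i := hω.2
      exact (h hω.1).symm.trans h3)
    exact h1.trans h2.symm) (by
    intro r hr
    -- Beyond `2 / r` each of the two error terms is at most `r / 2`.
    obtain ⟨n₀, hn₀⟩ := exists_L0N (P := P) (φ := fun ω => ⌈2 / r ω⌉₊)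
      (Nat.measurable_ceil.comp (measurable_const.div r.measurable))
    refine ⟨n₀, fun n m hn hm => L0.le_iff.2 ?_⟩
    filter_upwards [hnorm n m, hn₀, AEEqFun.coeFn_le.2 hn, AEEqFun.coeFn_le.2 hm,
      SLT_zero_iff.1 hr] with ω h1 h2 h3 h4 h5
    have h6 : 2 / r ω ≤ n₀ ω := by rw [h2]; exact Nat.le_ceil _
    have key : ∀ k : ℕ, n₀ ω ≤ k → 1 / ((k : ℝ) + 1) ≤ r ω / 2 := by
      intro k hk
      have h7 : (n₀ ω : ℝ) ≤ k := by exact_mod_cast hk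
      rw [div_le_div_iff₀ (by positivity) two_pos]
      rw [div_le_iff₀ h5] at h6
      nlinarith
    linarith [key _ h3, key _ h4])
  have hball : ∀ f ∈ N.dualBall, z f = f y := by
    intro f hf
    have h1 : ∀ m : ℕ, ∀ᵐ ω ∂P, |z f ω - f y ω| ≤ 2 * (1 / ((m : ℝ) + 1)) := by
      intro m
      obtain ⟨e, he, he'⟩ := exists_pos_const P (c := 1 / ((m : ℝ) + 1)) (by positivity)
      obtain ⟨c, hc⟩ := exists_L0N (P := P) (φ := fun _ => m) measurable_const
      obtain ⟨K, hK⟩ := Filter.mem_atTop_sets.1 (hy (basicNhd_mem_nhds (Q := {N.toFun})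
        (Set.mem_singleton _) N.norm_zero y he))
      have h2 : ∀ᵐ ω ∂P, N.toFun (y - X (K ⊔ c)) ω < e ω := hK _ le_sup_left
      have h3 : ∀ᵐ ω ∂P, f (y - X (K ⊔ c)) ω = f y ω - f (X (K ⊔ c)) ω := by
        rw [map_sub]; exact ae_sub _ _
      filter_upwards [h2, h3, he', hzX (K ⊔ c) f hf, hc, AEEqFun.coeFn_sup K c,
        N.mem_dualBall_iff.1 hf (y - X (K ⊔ c))] with ω h4 h5 h6 h7 h8 h9 h10
      have h11 : m ≤ (K ⊔ c) ω := by
        rw [h9, ← h8]; exact le_max_right _ _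
      have h12 : 1 / (((K ⊔ c) ω : ℝ) + 1) ≤ 1 / ((m : ℝ) + 1) := by gcongr
      rw [h5] at h10
      have h13 := _root_.abs_le.1 h7
      have h14 := _root_.abs_le.1 h10
      rw [_root_.abs_le]
      constructor <;> linarith
    rw [L0.eq_iff]
    filter_upwards [ae_all_iff.2 h1] with ω h2
    rw [← sub_eq_zero, ← abs_eq_zero]
    refine le_antisymm ?_ (abs_nonneg _)
    have h4 : Filter.Tendsto (fun n : ℕ => 2 * (1 / ((n : ℝ) + 1))) Filter.atTop (nhds (2 * 0)) :=
      tendsto_one_div_add_atTop_nhds_zero_nat.const_mul _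
    rw [mul_zero] at h4
    exact ge_of_tendsto' h4 h2
  refine ⟨y, fun f hf => ?_⟩
  obtain ⟨C, hC⟩ := N.mem_dual_iff.1 hf
  -- Division by the invertible bound `|C| + 1` moves `f` into the dual ball.
  obtain ⟨c, hc⟩ := exists_L0 (P := P) (φ := fun ω => |C ω| + 1) (C.measurable.abs.add_const _)
  obtain ⟨c', hc'⟩ := exists_L0 (P := P) (φ := fun ω => (|C ω| + 1)⁻¹)
    (C.measurable.abs.add_const _).inv
  have hcc : c * c' = 1 := by
    rw [L0.eq_iff]
    filter_upwards [hc, hc', ae_mul c c', ae_one (P := P)] with ω h1 h2 h3 h4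
    rw [h3, h4, h1, h2]
    exact mul_inv_cancel₀ (by positivity)
  have hf' : c' • f ∈ N.dualBall := by
    rw [N.mem_dualBall_iff]
    intro v
    filter_upwards [hC v, ae_smul c' (f v), hc', N.ae_nonneg v] with ω h1 h2 h3 h4
    rw [LinearMap.smul_apply, h2, h3, abs_mul, abs_of_pos (by positivity), inv_mul_eq_div,
      div_le_iff₀ (by positivity)]
    nlinarith [mul_le_mul_of_nonneg_right (le_abs_self (C ω)) h4]
  have h1 := hball _ hf'
  have h2 : f = c • (c' • f) := by rw [smul_smul, hcc, one_smul]
  rw [h2, hz.map_smul hf'.1, h1]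
  rfl

/-- Under James' condition, weak-* limits of `S` in the bidual belong to `E`. -/
theorem IsLimitOf.exists_eq_apply (hE : IsStableModule P E) (hN : N.IsStableComplete)
    (hball : IsStableSeqCompact P (weakStarTopology P E) N.dualBall)
    (hatt : ∀ f ∈ N.dual, ∃ y ∈ S, IsLUB (f '' S) (f y)) (hz : IsLimitOf N S z) {C : L0 P}
    (hC : ∀ x ∈ S, ∀ᵐ ω ∂P, N.toFun x ω ≤ C ω) : ∃ x : E, ∀ f ∈ N.dual, z f = f x := by
  have hneg : ∀ f ∈ N.dual, z (-f) = -z f := fun f hf => by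
    have := hz.map_smul hf (-1)
    rwa [neg_smul, one_smul, neg_one_mul] at this
  have hD : ∀ x, ∃ D : L0 P, IsLUB ((fun f : E →ₗ[L0 P] L0 P => z f - f x) '' N.dualBall) D := by
    intro x
    refine exists_isLUB_L0 (Set.Nonempty.image _ ⟨0, N.zero_mem_ball⟩) (b := C + N.toFun x) ?_
    rintro _ ⟨f, hf, rfl⟩
    rw [L0.le_iff]
    filter_upwards [hz.abs_le hC hf, N.mem_dualBall_iff.1 hf x, ae_sub (z f) (f x),
      ae_add C (N.toFun x)] with ω h1 h2 h3 h4
    rw [h3, h4]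
    linarith [(_root_.abs_le.1 h1).2, (_root_.abs_le.1 h2).1]
  -- `D x` plays the role of `‖z - x‖`; the symmetry of the ball makes absolute values unnecessary.
  choose D hD using hD
  have hDle : ∀ x, ∀ f ∈ N.dualBall, ∀ᵐ ω ∂P, z f ω - f x ω ≤ D x ω := by
    intro x f hf
    filter_upwards [L0.le_iff.1 ((hD x).1 ⟨f, hf, rfl⟩), ae_sub (z f) (f x)] with ω h1 h2
    rwa [h2] at h1
  have hlub : ∀ x (b : L0 P), (∀ f ∈ N.dualBall, ∀ᵐ ω ∂P, z f ω - f x ω ≤ b ω) → D x ≤ b := by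
    intro x b hb
    refine (hD x).2 ?_
    rintro _ ⟨f, hf, rfl⟩
    rw [L0.le_iff]
    filter_upwards [hb f hf, ae_sub (z f) (f x)] with ω h1 h2
    rwa [h2]
  have hloc' : ∀ (A : Set Ω) (hA : MeasurableSet A) (x y : E), AgreeOn (P := P) hA x y →
      ∀ᵐ ω ∂P, ω ∈ A → D x ω ≤ D y ω := by
    classical
    intro A hA x y h
    -- Replacing `D x` by `D y` on `A` still gives an upper bound, so the least one lies below it.
    obtain ⟨r, hr⟩ := exists_L0 (P := P) (φ := fun ω => if ω ∈ A then D y ω else D x ω)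
      (Measurable.ite hA (D y).measurable (D x).measurable)
    have h1 := hlub x r fun f hf => by
      filter_upwards [hr, hDle x f hf, hDle y f hf, agreeOn_L0.1 (h.map f)] with ω h1 h2 h3 h4
      rw [h1]
      split_ifs with hω
      · rwa [h4 hω]
      · exact h2
    filter_upwards [L0.le_iff.1 h1, hr] with ω h2 h3 hω
    rwa [h3, if_pos hω] at h2
  have hD0 : ∀ x, 0 ≤ D x := fun x => by
    have h1 := hneg 0 N.dual_zero
    rw [neg_zero] at h1
    rw [L0.nonneg_iff]
    filter_upwards [hDle x 0 N.zero_mem_ball, L0.eq_iff.1 h1, ae_neg (z 0), ae_zero (P := P)]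
      with ω h2 h3 h4 h5
    rw [LinearMap.zero_apply, h5] at h2
    linarith
  obtain ⟨d, hd0, hd, hd'⟩ := exists_almost_min (X := (Set.univ : Set E)) Set.univ_nonempty
    (fun a x _ => by
      obtain ⟨y, hy, -⟩ := hE a x
      exact ⟨y, trivial, hy⟩)
    (φ := D) (fun A hA x y _ _ h => by
      filter_upwards [hloc' A hA x y h, hloc' A hA y x h.symm] with ω h1 h2 hω
      exact le_antisymm (h1 hω) (h2 hω)) (b := 0) fun x _ => hD0 x
  have hdz := hz.dist_eq_zero hball hatt hC hd0 fun x b hb => (hd x trivial).trans (hlub x b hb)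
  refine hz.exists_represented hE hN fun n => ?_
  obtain ⟨e, he, he'⟩ := exists_pos_const P (c := 1 / ((n : ℝ) + 1)) (by positivity)
  obtain ⟨x, -, hx⟩ := hd' e he
  rw [hdz, zero_add] at hx
  refine ⟨x, fun f hf => ?_⟩
  filter_upwards [hDle x f hf, hDle x _ (N.ball_neg hf), L0.le_iff.1 hx, he',
    L0.eq_iff.1 (hneg f hf.1), ae_neg (z f), ae_neg (f x)] with ω h1 h2 h3 h4 h5 h6 h7
  rw [LinearMap.neg_apply, h5, h6, h7] at h2
  rw [_root_.abs_le]
  constructor <;> linarith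

end James

end StableModule

end

/-! ### The characterisation of weak stable compactness. -/

open StableModule in
theorem mainTheorem7 {Ω : Type*} [MeasurableSpace Ω] (P : MeasureTheory.Measure Ω)
    [MeasureTheory.IsProbabilityMeasure P]
    {E : Type*} [AddCommGroup E] [Module (L0 P) E] (hE : IsStableModule P E)
    (N : L0Norm P E) (hN : N.IsStableComplete)
    (hball : IsStableSeqCompact P (weakStarTopology P E) N.dualBall)
    (S : Set E) (hS : IsStableSet P S) (hclosed : @IsClosed E N.weakTopology S) :
    IsStableCompact P N.weakTopology S ↔
      ∀ f ∈ N.dual, ∃ y ∈ S, IsLUB (f '' S) (f y) := by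
  classical
  constructor
  · exact fun hc f hf => isStableCompact_exists_isLUB hE hS hc f ⟨f, hf, rfl⟩
  intro hatt F hF
  obtain ⟨B, hB, hSB, hBF⟩ := exists_isMaximalBase hS hF
  have hbd : ∀ f ∈ N.dual, ∃ C : L0 P, ∀ x ∈ S, ∀ᵐ ω ∂P, |f x ω| ≤ C ω := by
    intro f hf
    obtain ⟨y, hy, hy'⟩ := hatt f hf
    obtain ⟨v, hv, hv'⟩ := hatt _ (N.dual_neg hf)
    obtain ⟨C, hC⟩ := exists_L0 (P := P) (φ := fun ω => max (f y ω) (-f v ω))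
      ((f y).measurable.max (f v).measurable.neg)
    refine ⟨C, fun x hx => ?_⟩
    filter_upwards [hC, L0.le_iff.1 (hy'.1 (Set.mem_image_of_mem f hx)),
      L0.le_iff.1 (hv'.1 (Set.mem_image_of_mem _ hx)), ae_neg (f x), ae_neg (f v)]
      with ω h1 h2 h3 h4 h5
    rw [LinearMap.neg_apply, LinearMap.neg_apply, h4, h5] at h3
    rw [h1, abs_le]
    constructor
    · linarith [le_max_right (f y ω) (-f v ω)]
    · exact h2.trans (le_max_left _ _)
  obtain ⟨C, hC⟩ := N.exists_bound_of_weakly_bounded hE hS hbd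
  -- Limits along the base are chosen on the dual only; outside it the value `0` is never used.
  have hlim : ∀ f : E →ₗ[L0 P] L0 P, ∃ z : L0 P, f ∈ N.dual → ∀ ε : L0 P, SLT P 0 ε →
      {x | ∀ᵐ ω ∂P, |f x ω - z ω| ≤ ε ω} ∈ B := by
    intro f
    by_cases hf : f ∈ N.dual
    · obtain ⟨D, hD⟩ := hbd f hf
      obtain ⟨z, hz⟩ := hB.exists_limit hE hSB f hD
      exact ⟨z, fun _ => hz⟩
    · exact ⟨0, fun h => absurd h hf⟩
  choose z hz using hlim
  have hzl : IsLimitOf N S z := by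
    intro s hs ε hε
    obtain ⟨x, hx, hx'⟩ := (hB.stable _ (hB.finset_inter hSB s _ fun f hf => hz f (hs f hf) ε hε)).1
    exact ⟨x, hx, hx'⟩
  obtain ⟨x, hx⟩ := hzl.exists_eq_apply hE hN hball hatt hC
  have hnhds : ∀ U : Set E, @IsOpen E N.weakTopology U → x ∈ U → ∃ V ∈ B, V ⊆ U := fun U hU hxU =>
    hB.exists_subset_of_isOpen N hE hSB (fun f hf ε hε => by
      rw [← hx f hf]; exact hz f hf ε hε) hU hxU
  let _ : TopologicalSpace E := N.weakTopology
  refine ⟨x, ?_, ?_⟩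
  -- Were `x` outside the closed set `S`, a member of the base would lie in the complement of `S`,
  -- yet it must meet `S`.
  · by_contra hxS
    obtain ⟨V, hV, hVS⟩ := hnhds Sᶜ hclosed.isOpen_compl hxS
    obtain ⟨y, hy, hy'⟩ := (hB.stable _ (hB.inter V hV S hSB)).1
    exact hVS hy hy'
  · rw [clusterPt_iff_nonempty]
    intro U hU W hW
    obtain ⟨U', hU', hU'o, hxU'⟩ := mem_nhds_iff.1 hU
    obtain ⟨V, hV, hVU⟩ := hnhds U' hU'o hxU'
    obtain ⟨V', hV', hVW⟩ := hBF W hW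
    exact ((hB.stable _ (hB.inter V hV V' hV')).1).mono
      (Set.inter_subset_inter (hVU.trans hU') hVW)
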